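/- **Setting.** Let $G=(V,E)$ be a connected, non-bipartite graph with $n\ge 2$ nodes, and let $(p_e)_{e\in E}$ satisfy $p_e>0$ and $\sum_{e\in E}p_e=1$. Node $k$ holds a real observation $X_k$, and the $X_k$ are pairwise distinct. Let $0<\alpha<1/2$, $m=\lfloor\alpha n\rfloor$, $a=m+\tfrac12$, $b=n-m+\tfrac12$, $r_k=1+\#\{l: X_l<X_k\}$, let $\bar x_\alpha=\frac1{n-2m}\sum_{k:\,m+1\le r_k\le n-m}X_k$ be the trimmed mean, and let $w(r)=\mathbb I\{a\le r\le b\}/(1-2m/n)$. **Synchronous GoTrim.** Put $Y_k(0)=X_k$, $R'_k(0)=0$, $W_k(0)=0$, $N_k(0)=0$. At each iteration $t=1,2,\dots$, every node $k$ sets $$R'_k(t)=\bigl(1-\tfrac1t\bigr)R'_k(t-1)+\tfrac1t\,\mathbb I\{X_k>Y_k(t-1)\},\qquad R_k(t)=nR'_k(t)+1,\qquad W_k(t)=w(R_k(t)).$$ Then an edge $\{i,j\}$ is drawn with law $p$, independently of the past, and $$\mathbf N(t)=\mathbf W_2(t)\bigl(\mathbf N(t-1)+(\mathbf W(t)-\mathbf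 W(t-1))\odot \mathbf X\bigr),\qquad \mathbf W_2(t)=\mathbf I_n-\tfrac12(\mathbf e_i-\mathbf e_j)(\mathbf e_i-\mathbf e_j)^\top ,$$ while $Y(t)$ is obtained from $Y(t-1)$ by swapping the entries $i$ and $j$. **Constants.** Let $c$ be the second smallest eigenvalue of $\sum_{\{i,j\}\in E}p_{\{i,j\}}(\mathbf e_i-\mathbf e_j)(\mathbf e_i-\mathbf e_j)^\top$, let $\lambda_2(2)$ be the second largest eigenvalue of $\mathbb E[\mathbf W_2(t)]$, and let $\tilde c=1-\sqrt{\lambda_2(2)}$. Let $\sigma_n(r)=n^{3/2}\sqrt{u(1-u)}$ with $u=(r-1)/n$, $\gamma_k=\min(|r_k-a|,|r_k-b|)$, and $K_k=\dfrac{\sqrt6\,\sigma_n(r_k)}{\gamma_k(1-2\alpha)}$. **Theorem.** There is a universal constant $C>0$ such that, in every such setting, there is $T^*>0$ with $$\mathbb E\bigl\|\mathbf N(t)-\bar x_\alpha\mathbf 1_n\bigr\|_2\;\le\;\frac{C}{\tilde c\,\sqrt{c\,t}}\;\|\mathbf K\odot\mathbf X\|_2\qquad\text{for every integer } t>T^*.$$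 Here $T^*$ is bounded by a quantity that depends only on $\tilde c$ if $\lfloor\alpha n\rfloor\ge1$, and only on $\tilde c$ and $\mathbf X$ in general. -/

import Mathlib

open MeasureTheory ProbabilityTheory

namespace GoTrim

variable {V : Type*} [Fintype V] [DecidableEq V]

noncomputable section

/-! ### The data: ranks, trimmed mean, weights -/

/-- The number `m = ⌊α n⌋` of observations trimmed on each side. -/
def trimCount (V : Type*) [Fintype V] (α : ℝ) : ℕ := ⌊α * (Fintype.card V : ℝ)⌋₊

/-- The rank `r_k = 1 + #{l : X_l < X_k}`. -/
def rank (X : V → ℝ) (k : V) : ℕ := 1 + (Finset.univ.filter fun l => X l < X k).card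

/-- The `α`-trimmed mean: average of the `n - 2m` observations with rank in `[m + 1, n - m]`. -/
def trimmedMean (α : ℝ) (X : V → ℝ) : ℝ :=
  (∑ k ∈ Finset.univ.filter (fun k => trimCount V α + 1 ≤ rank X k ∧
      rank X k + trimCount V α ≤ Fintype.card V), X k) /
    ((Fintype.card V : ℝ) - 2 * (trimCount V α : ℝ))

/-- Left endpoint `a = m + 1/2` of the inclusion interval. -/
def leftEnd (V : Type*) [Fintype V] (α : ℝ) : ℝ := (trimCount V α : ℝ) + 1 / 2

/-- Right endpoint `b = n - m + 1/2` of the inclusion interval. -/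
def rightEnd (V : Type*) [Fintype V] (α : ℝ) : ℝ :=
  (Fintype.card V : ℝ) - (trimCount V α : ℝ) + 1 / 2

open Classical in
/-- The weight function `w(r) = 1{a ≤ r ≤ b} / (1 - 2 m / n)`. -/
def weightFun (V : Type*) [Fintype V] (α : ℝ) (r : ℝ) : ℝ :=
  if leftEnd V α ≤ r ∧ r ≤ rightEnd V α then
    1 / (1 - 2 * (trimCount V α : ℝ) / (Fintype.card V : ℝ))
  else 0

/-- `γ_k = min (|r_k - a|) (|r_k - b|)`. -/
def gap (α : ℝ) (X : V → ℝ) (k : V) : ℝ :=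
  min |(rank X k : ℝ) - leftEnd V α| |(rank X k : ℝ) - rightEnd V α|

/-- `φ(u) = √(u (1 - u))`. -/
def score (u : ℝ) : ℝ := √(u * (1 - u))

/-- `σ_n(r) = n ^ (3/2) φ((r - 1) / n)`. -/
def rankSigma (n : ℕ) (r : ℝ) : ℝ := (n : ℝ) ^ (3 / 2 : ℝ) * score ((r - 1) / (n : ℝ))

/-- `K_k = √6 σ_n(r_k) / (γ_k (1 - 2α))`. -/
def coeffK (α : ℝ) (X : V → ℝ) (k : V) : ℝ :=
  √6 * rankSigma (Fintype.card V) (rank X k : ℝ) / (gap α X k * (1 - 2 * α))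

/-! ### Edge sampling and spectral quantities -/

/-- `p` is a probability distribution on the edges of `G` charging every edge. -/
structure IsEdgeDistribution (G : SimpleGraph V) (p : Sym2 V → ℝ) : Prop where
  pos : ∀ e ∈ G.edgeSet, 0 < p e
  zero : ∀ e ∉ G.edgeSet, p e = 0
  sum_one : ∑ e, p e = 1

/-- `ξ 1, ξ 2, …` are independent random edges with common distribution `p`;
`ξ t` is the edge drawn at iteration `t`. -/
structure IsEdgeSampling {Ω : Type*} [MeasurableSpace Ω] (μ : Measure Ω) (p : Sym2 V → ℝ)
    (ξ : ℕ → Ω → Sym2 V) : Prop where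
  measurable : ∀ t, Measurable[_, ⊤] (ξ t)
  law : ∀ t e, μ.real (ξ t ⁻¹' {e}) = p e
  indep : iIndepFun (m := fun _ => (⊤ : MeasurableSpace (Sym2 V))) ξ μ

/-- The elementary Laplacian `L_e = (e_i - e_j) (e_i - e_j)ᵀ` of `e = {i, j}`. -/
def edgeLaplacian : Sym2 V → Matrix V V ℝ :=
  Sym2.lift ⟨fun i j => Matrix.vecMulVec (Pi.single i 1 - Pi.single j 1 : V → ℝ)
      (Pi.single i 1 - Pi.single j 1 : V → ℝ), fun i j => by
    beta_reduce
    rw [← neg_sub (Pi.single j 1 : V → ℝ) (Pi.single i 1), Matrix.neg_vecMulVec,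
      Matrix.vecMulVec_neg, neg_neg]⟩

/-- The averaging matrix `W_2 = I - L_e / 2` of an edge. -/
def averagingMatrix (e : Sym2 V) : Matrix V V ℝ := 1 - (1 / 2 : ℝ) • edgeLaplacian e

/-- The Laplacian `L(P) = ∑_e p_e L_e` of the weighted graph. -/
def laplacian (p : Sym2 V → ℝ) : Matrix V V ℝ := ∑ e, p e • edgeLaplacian e

/-- The expectation `∑_e p_e W_2(e)` of the averaging matrix of a random edge. -/
def meanAveragingMatrix (p : Sym2 V → ℝ) : Matrix V V ℝ := ∑ e, p e • averagingMatrix e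

theorem edgeLaplacian_isHermitian {V : Type*} [DecidableEq V] (e : Sym2 V) : (edgeLaplacian e).IsHermitian := by
  induction e using Sym2.ind with
  | _ i j =>
    ext a b
    simp [edgeLaplacian, Matrix.vecMulVec_apply, mul_comm]

theorem averagingMatrix_isHermitian {V : Type*} [DecidableEq V] (e : Sym2 V) : (averagingMatrix e).IsHermitian :=
  Matrix.isHermitian_one.sub ((edgeLaplacian_isHermitian e).smul (IsSelfAdjoint.all _))

theorem laplacian_isHermitian (p : Sym2 V → ℝ) : (laplacian p).IsHermitian :=
  isSelfAdjoint_sum _ fun e _ => (edgeLaplacian_isHermitian e).smul (IsSelfAdjoint.all _)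

theorem meanAveragingMatrix_isHermitian (p : Sym2 V → ℝ) : (meanAveragingMatrix p).IsHermitian :=
  isSelfAdjoint_sum _ fun e _ => (averagingMatrix_isHermitian e).smul (IsSelfAdjoint.all _)

/-- The spectral gap `c`: second smallest eigenvalue (with multiplicity) of `L(P)`.
The family `eigenvalues₀` is in decreasing order and indexed from `0`. -/
def spectralGap [Nontrivial V] (p : Sym2 V → ℝ) : ℝ :=
  (laplacian_isHermitian p).eigenvalues₀
    ⟨Fintype.card V - 2, Nat.sub_lt Fintype.card_pos two_pos⟩

/-- `λ₂(2)`: second largest eigenvalue (with multiplicity) of the mean averaging matrix. -/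
def lambdaTwo [Nontrivial V] (p : Sym2 V → ℝ) : ℝ :=
  (meanAveragingMatrix_isHermitian p).eigenvalues₀ ⟨1, Fintype.one_lt_card⟩

/-- `c̃ = 1 - √λ₂(2)`. -/
def cTilde [Nontrivial V] (p : Sym2 V → ℝ) : ℝ := 1 - √(lambdaTwo p)

/-! ### The synchronous algorithm along a sequence of edges `e 1, e 2, …`

At iteration `t ≥ 1` every node updates its rank estimate by comparing its observation with the
auxiliary observation it holds, updates its weight, and injects the change of weight times its
observation into its estimate; then the edge `e t` is drawn, its two nodes average their estimates
and swap their auxiliary observations. -/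

/-- Exchange of the two endpoints of an edge. -/
def swapEdge : Sym2 V → Equiv.Perm V :=
  Sym2.lift ⟨fun i j => Equiv.swap i j, fun i j => Equiv.swap_comm i j⟩

/-- The auxiliary observations `Y(t)` after `t` iterations. -/
def auxObs (X : V → ℝ) (e : ℕ → Sym2 V) : ℕ → V → ℝ
  | 0 => X
  | t + 1 => fun k => auxObs X e t (swapEdge (e (t + 1)) k)

open Classical in
/-- The normalized rank estimates `R'(t)`: running averages of the comparisons. -/
def normRankEst (X : V → ℝ) (e : ℕ → Sym2 V) : ℕ → V → ℝ
  | 0 => fun _ => 0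
  | t + 1 => fun k => (1 - 1 / ((t + 1 : ℕ) : ℝ)) * normRankEst X e t k +
      1 / ((t + 1 : ℕ) : ℝ) * (if auxObs X e t k < X k then 1 else 0)

/-- The rank estimates `R(t) = n R'(t) + 1`. -/
def rankEst (X : V → ℝ) (e : ℕ → Sym2 V) (t : ℕ) (k : V) : ℝ :=
  (Fintype.card V : ℝ) * normRankEst X e t k + 1

/-- The weights `W(t)`: initially zero, then `w(R(t))`. -/
def weight (α : ℝ) (X : V → ℝ) (e : ℕ → Sym2 V) : ℕ → V → ℝ
  | 0 => fun _ => 0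
  | t + 1 => fun k => weightFun V α (rankEst X e (t + 1) k)

/-- The estimates `N(t) = W_2(e t) (N(t - 1) + (W(t) - W(t - 1)) ⊙ X)`, with `N(0) = 0`. -/
def estimate (α : ℝ) (X : V → ℝ) (e : ℕ → Sym2 V) : ℕ → V → ℝ
  | 0 => fun _ => 0
  | t + 1 => (averagingMatrix (e (t + 1))).mulVec
      (estimate α X e t + (weight α X e (t + 1) - weight α X e t) * X)

/-- The Euclidean norm of a real vector indexed by `V`. -/
def l2norm (v : V → ℝ) : ℝ := ‖(WithLp.toLp 2 v : EuclideanSpace ℝ V)‖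

end

end GoTrim

set_option linter.unusedSectionVars false

namespace GoTrim

/-! ### One edge: swapping and averaging through its Laplacian -/

variable {V : Type*} [Fintype V] [DecidableEq V]

/-! Averaging preserves sums and the injections telescope, so the mean of `N(t)` is the mean of
`W(t) ⊙ X`. The error `N(t) - x̄ 1` therefore splits into the mean of the weight errors and the
deviation of `N(t)` from its own mean. Both are controlled by the weight error, whose mean-square
norm is at most `B / √(c t)` with `B = ‖K ⊙ X‖` (`integral_weightError_le`).

Weights. The true rank lies at distance `γ_k` from the jumps of `w`, so a weight is wrong only if
the rank estimate is off by at least `γ_k`; a Chebyshev-type bound reduces the weight error to the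
mean square error of the rank. The rank error is a time average of centred comparisons. At lag `d`
their correlations form the orbit `f_{d+1} = (I - L) f_d` of a centred vector, with `L = L(P)`. No
decay of the orbit is needed: a partial sum `g` satisfies `L g = f_0 - f_D`, and the Poincaré
inequality bounds it by a multiple of `1/c` (`sum_orbit_le`).

Consensus. `W_2` is an orthogonal projection, so one random averaging contracts the root mean square
of the centred part by `√λ₂(2) = 1 - c̃`. For `t ≥ 1` the injection is a difference of two weight
errors, of size at most `2B / √(c t)`. The recursion `z_{t+1} ≤ (1 - c̃)(z_t + A/√t)` then gives
`O(A / (c̃ √t))` (`recursion_le`).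

First injection. Since `W(0) = 0` and every node first compares its value with itself, iteration 1
injects `w(1) X`. This vanishes if `m ≥ 1`. If `m = 0` it leaves a term at most `(1 - c̃)^t ‖X‖`,
eventually below the main bound because `B > 0` once `n ≥ 3`, which non-bipartiteness ensures; this
is where `T*` depends on `X`. -/

theorem edgeLaplacian_mulVec (i j : V) (x : V → ℝ) :
    (edgeLaplacian s(i, j)).mulVec x =
      (x i - x j) • (Pi.single i 1 - Pi.single j 1 : V → ℝ) := by
  have h : edgeLaplacian s(i, j) = Matrix.vecMulVec (Pi.single i 1 - Pi.single j 1 : V → ℝ)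
      (Pi.single i 1 - Pi.single j 1 : V → ℝ) := rfl
  rw [h, Matrix.vecMulVec_mulVec]
  simp only [sub_dotProduct, single_dotProduct, one_mul, op_smul_eq_smul]

theorem dotProduct_edgeLaplacian_mulVec (i j : V) (x y : V → ℝ) :
    y ⬝ᵥ (edgeLaplacian s(i, j)).mulVec x = (x i - x j) * (y i - y j) := by
  rw [edgeLaplacian_mulVec]
  simp [dotProduct_sub]

/-- Swap and averaging are `I - L_e` and `I - L_e / 2`, so the same matrix `L(P)` governs the means
of both. -/
theorem comp_swapEdge (e : Sym2 V) (x : V → ℝ) (k : V) :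
    x (swapEdge e k) = x k - (edgeLaplacian e).mulVec x k := by
  induction e using Sym2.ind with
  | _ i j =>
    have h : swapEdge s(i, j) = Equiv.swap i j := rfl
    rw [edgeLaplacian_mulVec, h]
    by_cases hi : k = i
    · subst hi
      by_cases hj : k = j
      · subst hj; simp
      · simp [hj]
    · by_cases hj : k = j
      · subst hj; simp [hi]
      · simp [hi, hj, Equiv.swap_apply_of_ne_of_ne hi hj]

theorem averagingMatrix_mulVec (e : Sym2 V) (x : V → ℝ) :
    (averagingMatrix e).mulVec x = x - (1 / 2 : ℝ) • (edgeLaplacian e).mulVec x := by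
  simp [averagingMatrix, Matrix.sub_mulVec, Matrix.smul_mulVec]

/-- Averaging over an edge is an orthogonal projection. -/
theorem averagingMatrix_mulVec_dotProduct_self (e : Sym2 V) (x : V → ℝ) :
    (averagingMatrix e).mulVec x ⬝ᵥ (averagingMatrix e).mulVec x =
      x ⬝ᵥ (averagingMatrix e).mulVec x := by
  induction e using Sym2.ind with
  | _ i j =>
    rw [averagingMatrix_mulVec]
    have h1 := dotProduct_edgeLaplacian_mulVec i j x x
    have h2 := dotProduct_edgeLaplacian_mulVec i j x ((edgeLaplacian s(i, j)).mulVec x)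
    -- `L_e² = 2 L_e`, which is what makes `I - L_e / 2` idempotent.
    have h3 : (edgeLaplacian s(i, j)).mulVec x i - (edgeLaplacian s(i, j)).mulVec x j =
        2 * (x i - x j) := by
      rw [edgeLaplacian_mulVec]
      by_cases hij : i = j
      · subst hij; simp
      · simp [hij, Ne.symm hij]; ring
    rw [h3] at h2
    simp only [sub_dotProduct, dotProduct_sub, smul_dotProduct, dotProduct_smul, smul_eq_mul]
    rw [dotProduct_comm ((edgeLaplacian s(i, j)).mulVec x) x, h1, h2]
    ring

theorem sum_edgeLaplacian_mulVec (e : Sym2 V) (x : V → ℝ) :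
    ∑ k, (edgeLaplacian e).mulVec x k = 0 := by
  induction e using Sym2.ind with
  | _ i j =>
    rw [edgeLaplacian_mulVec]
    simp [← Finset.mul_sum]

theorem sum_averagingMatrix_mulVec (e : Sym2 V) (x : V → ℝ) :
    ∑ k, (averagingMatrix e).mulVec x k = ∑ k, x k := by
  rw [averagingMatrix_mulVec]
  simp [← Finset.mul_sum, sum_edgeLaplacian_mulVec]

theorem edgeLaplacian_mulVec_const (e : Sym2 V) (a : ℝ) :
    (edgeLaplacian e).mulVec (fun _ => a) = 0 := by
  induction e using Sym2.ind with
  | _ i j => rw [edgeLaplacian_mulVec]; simp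

theorem averagingMatrix_mulVec_const (e : Sym2 V) (a : ℝ) :
    (averagingMatrix e).mulVec (fun _ => a) = fun _ => a := by
  rw [averagingMatrix_mulVec, edgeLaplacian_mulVec_const]; simp

theorem laplacian_mulVec (p : Sym2 V → ℝ) (x : V → ℝ) :
    (laplacian p).mulVec x = ∑ e, p e • (edgeLaplacian e).mulVec x := by
  simp [laplacian, Matrix.sum_mulVec, Matrix.smul_mulVec]

theorem meanAveragingMatrix_mulVec (p : Sym2 V → ℝ) (x : V → ℝ) :
    (meanAveragingMatrix p).mulVec x = ∑ e, p e • (averagingMatrix e).mulVec x := by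
  simp [meanAveragingMatrix, Matrix.sum_mulVec, Matrix.smul_mulVec]

theorem sum_laplacian_mulVec (p : Sym2 V → ℝ) (x : V → ℝ) :
    ∑ k, (laplacian p).mulVec x k = 0 := by
  rw [laplacian_mulVec]
  simp only [Finset.sum_apply, Pi.smul_apply, smul_eq_mul]
  rw [Finset.sum_comm]
  simp [← Finset.mul_sum, sum_edgeLaplacian_mulVec]

theorem laplacian_mulVec_const (p : Sym2 V → ℝ) (a : ℝ) :
    (laplacian p).mulVec (fun _ => a) = 0 := by
  rw [laplacian_mulVec]; simp [edgeLaplacian_mulVec_const]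

theorem dotProduct_edgeLaplacian_mulVec_self_nonneg (e : Sym2 V) (x : V → ℝ) :
    0 ≤ x ⬝ᵥ (edgeLaplacian e).mulVec x := by
  induction e using Sym2.ind with
  | _ i j => rw [dotProduct_edgeLaplacian_mulVec]; exact mul_self_nonneg _

theorem dotProduct_comp_swapEdge_self (e : Sym2 V) (x : V → ℝ) :
    ∑ k, x (swapEdge e k) ^ 2 = x ⬝ᵥ x := by
  rw [Equiv.sum_comp (swapEdge e) (fun k => x k ^ 2)]
  simp [dotProduct, sq]

/-! ### The Laplacian of a random edge -/

section Distribution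

variable {G : SimpleGraph V} {p : Sym2 V → ℝ}

theorem IsEdgeDistribution.nonneg (hp : IsEdgeDistribution G p) (e : Sym2 V) : 0 ≤ p e := by
  by_cases he : e ∈ G.edgeSet
  · exact (hp.pos e he).le
  · exact (hp.zero e he).ge

theorem IsEdgeDistribution.meanAveragingMatrix_mulVec (hp : IsEdgeDistribution G p) (x : V → ℝ) :
    (meanAveragingMatrix p).mulVec x = x - (1 / 2 : ℝ) • (laplacian p).mulVec x := by
  rw [GoTrim.meanAveragingMatrix_mulVec, laplacian_mulVec]
  simp only [averagingMatrix_mulVec, smul_sub, Finset.sum_sub_distrib, ← Finset.sum_smul,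
    hp.sum_one, one_smul, Finset.smul_sum]
  congr 1
  exact Finset.sum_congr rfl fun e _ => smul_comm _ _ _

/-- The mean effect of swapping the endpoints of a random edge. -/
theorem IsEdgeDistribution.sum_mul_comp_swapEdge (hp : IsEdgeDistribution G p) (x : V → ℝ) (k : V) :
    ∑ e, p e * x (swapEdge e k) = x k - (laplacian p).mulVec x k := by
  simp only [comp_swapEdge, mul_sub, Finset.sum_sub_distrib, ← Finset.sum_mul, hp.sum_one, one_mul,
    laplacian_mulVec, Finset.sum_apply, Pi.smul_apply, smul_eq_mul]

theorem dotProduct_laplacian_mulVec (p : Sym2 V → ℝ) (x : V → ℝ) :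
    x ⬝ᵥ (laplacian p).mulVec x = ∑ e, p e * (x ⬝ᵥ (edgeLaplacian e).mulVec x) := by
  simp [laplacian_mulVec, dotProduct_sum, dotProduct_smul]

theorem IsEdgeDistribution.dotProduct_laplacian_mulVec_nonneg (hp : IsEdgeDistribution G p)
    (x : V → ℝ) : 0 ≤ x ⬝ᵥ (laplacian p).mulVec x := by
  rw [dotProduct_laplacian_mulVec]
  exact Finset.sum_nonneg fun e _ => mul_nonneg (hp.nonneg e)
    (dotProduct_edgeLaplacian_mulVec_self_nonneg e x)

/-- A vector of zero Dirichlet energy is constant when the graph is connected. -/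
theorem IsEdgeDistribution.eq_of_dotProduct_laplacian_mulVec_nonpos (hp : IsEdgeDistribution G p)
    (hG : G.Connected) {x : V → ℝ} (hx : x ⬝ᵥ (laplacian p).mulVec x ≤ 0) (i j : V) :
    x i = x j := by
  have h0 := le_antisymm hx (hp.dotProduct_laplacian_mulVec_nonneg x)
  rw [dotProduct_laplacian_mulVec, Finset.sum_eq_zero_iff_of_nonneg fun e _ =>
    mul_nonneg (hp.nonneg e) (dotProduct_edgeLaplacian_mulVec_self_nonneg e x)] at h0
  have hadj : ∀ a b, G.Adj a b → x a = x b := by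
    intro a b hab
    have h := h0 s(a, b) (Finset.mem_univ _)
    have hpos := hp.pos s(a, b) hab
    rw [dotProduct_edgeLaplacian_mulVec] at h
    have h2 : x a - x b = 0 := by
      rcases mul_eq_zero.1 h with h | h
      · exact absurd h hpos.ne'
      · exact mul_self_eq_zero.1 h
    linarith
  obtain ⟨w⟩ := hG.preconnected i j
  induction w with
  | nil => rfl
  | cons h _ ih => exact (hadj _ _ h).trans ih

/-- The mean swap `1 - L(P)` is a contraction. -/
theorem IsEdgeDistribution.dotProduct_self_sub_laplacian_le (hp : IsEdgeDistribution G p)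
    (x : V → ℝ) :
    (x - (laplacian p).mulVec x) ⬝ᵥ (x - (laplacian p).mulVec x) ≤ x ⬝ᵥ x := by
  have hk : ∀ k, (x - (laplacian p).mulVec x) k * (x - (laplacian p).mulVec x) k ≤
      ∑ e, p e * x (swapEdge e k) ^ 2 := by
    intro k
    rw [Pi.sub_apply, ← hp.sum_mul_comp_swapEdge x k, ← sq]
    -- Jensen in each coordinate; summing over coordinates then uses that swaps preserve the norm.
    exact Real.pow_arith_mean_le_arith_mean_pow_of_even _ _ _ (fun e _ => hp.nonneg e) hp.sum_one
      even_two
  calc _ ≤ ∑ k, ∑ e, p e * x (swapEdge e k) ^ 2 := Finset.sum_le_sum fun k _ => hk k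
    _ = x ⬝ᵥ x := by
      rw [Finset.sum_comm]
      simp only [← Finset.mul_sum, dotProduct_comp_swapEdge_self, ← Finset.sum_mul, hp.sum_one,
        one_mul]

end Distribution

/-! ### Spectral estimates -/

theorem ofLp_dotProduct_self (x : EuclideanSpace ℝ V) : x.ofLp ⬝ᵥ x.ofLp = ‖x‖ ^ 2 := by
  rw [EuclideanSpace.norm_sq_eq]; simp [dotProduct, sq]

theorem inner_eq_ofLp_dotProduct (x y : EuclideanSpace ℝ V) :
    inner ℝ x y = x.ofLp ⬝ᵥ y.ofLp := by
  rw [EuclideanSpace.inner_eq_star_dotProduct]; simp [dotProduct_comm]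

/-- If `A` is diagonal in an orthonormal basis, with all eigenvalues but one at most `κ`, and `1` is
an eigenvector for an eigenvalue above `κ`, then `A ≤ κ` on the orthogonal complement of `1`. -/
theorem dotProduct_mulVec_le_of_orthonormalBasis (A : Matrix V V ℝ)
    (b : OrthonormalBasis V ℝ (EuclideanSpace ℝ V)) (l : V → ℝ)
    (hb : ∀ i, A.mulVec (b i).ofLp = l i • (b i).ofLp) {θ κ : ℝ} (hA : A.IsHermitian)
    (h1 : A.mulVec (fun _ => 1) = θ • fun _ => 1) (i₀ : V) (hl : ∀ i ≠ i₀, l i ≤ κ) (hκ : κ < θ)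
    (x : V → ℝ) (hx : ∑ k, x k = 0) : x ⬝ᵥ A.mulVec x ≤ κ * (x ⬝ᵥ x) := by
  have hsymm : ∀ i (y : V → ℝ), (b i).ofLp ⬝ᵥ A.mulVec y = l i * ((b i).ofLp ⬝ᵥ y) := by
    intro i y
    have hT : A.transpose = A := by rw [← Matrix.conjTranspose_eq_transpose_of_trivial]; exact hA
    rw [Matrix.dotProduct_mulVec, ← Matrix.mulVec_transpose, hT, hb, smul_dotProduct, smul_eq_mul]
  -- Eigenvectors of a symmetric matrix for different eigenvalues are orthogonal, so the vector `1`
  -- is a multiple of `b i₀`, and the centred `x` is orthogonal to `b i₀`.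
  have horth : ∀ i ≠ i₀, (b i).ofLp ⬝ᵥ (fun _ => (1 : ℝ)) = 0 := by
    intro i hi
    have h := hsymm i (fun _ => 1)
    rw [h1, dotProduct_smul, smul_eq_mul] at h
    have := hl i hi
    have h' : (θ - l i) * ((b i).ofLp ⬝ᵥ (fun _ => (1 : ℝ))) = 0 := by linarith
    rcases mul_eq_zero.1 h' with h' | h'
    · linarith
    · exact h'
  set o : EuclideanSpace ℝ V := WithLp.toLp 2 (fun _ => (1 : ℝ)) with ho
  set X : EuclideanSpace ℝ V := WithLp.toLp 2 x with hX
  have hone : o = (inner ℝ (b i₀) o) • b i₀ := by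
    conv_lhs => rw [← b.sum_repr' o]
    refine Finset.sum_eq_single i₀ (fun i _ hi => ?_) (by simp)
    rw [inner_eq_ofLp_dotProduct, horth i hi, zero_smul]
  have hx0 : (b i₀).ofLp ⬝ᵥ x = 0 := by
    have h0 : inner ℝ o X = 0 := by
      rw [inner_eq_ofLp_dotProduct]; simpa [ho, hX, dotProduct] using hx
    rw [hone, inner_smul_left] at h0
    rcases mul_eq_zero.1 h0 with h | h
    · have h2 : inner ℝ (b i₀) o = 0 := by simpa using h
      rw [h2, zero_smul] at hone
      have h3 := congrArg (fun y : EuclideanSpace ℝ V => y i₀) hone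
      simp [ho] at h3
    · rw [inner_eq_ofLp_dotProduct] at h; exact h
  have e1 : x ⬝ᵥ x = ∑ i, ((b i).ofLp ⬝ᵥ x) * ((b i).ofLp ⬝ᵥ x) := by
    have h := b.sum_inner_mul_inner X X
    simp only [inner_eq_ofLp_dotProduct] at h
    rw [hX] at h
    simp only at h
    rw [← h]
    exact Finset.sum_congr rfl fun i _ => by rw [dotProduct_comm x]
  have e2 : x ⬝ᵥ A.mulVec x = ∑ i, l i * (((b i).ofLp ⬝ᵥ x) * ((b i).ofLp ⬝ᵥ x)) := by
    have h := b.sum_inner_mul_inner X (WithLp.toLp 2 (A.mulVec x))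
    simp only [inner_eq_ofLp_dotProduct] at h
    rw [hX] at h
    simp only at h
    rw [← h]
    exact Finset.sum_congr rfl fun i _ => by rw [dotProduct_comm x, hsymm]; ring
  rw [e1, e2, Finset.mul_sum]
  refine Finset.sum_le_sum fun i _ => ?_
  by_cases hi : i = i₀
  · rw [hi, hx0]; simp
  · exact mul_le_mul_of_nonneg_right (hl i hi) (mul_self_nonneg _)

section Spectral

variable {G : SimpleGraph V} {p : Sym2 V → ℝ} [Nontrivial V]

/-- The vertex labelling the eigenvector of the `i`-th largest eigenvalue. -/
noncomputable def eigenIndex (V : Type*) [Fintype V] : Fin (Fintype.card V) ≃ V :=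
  Fintype.equivOfCardEq (Fintype.card_fin _)

theorem eigenvalues_eigenIndex {A : Matrix V V ℝ} (hA : A.IsHermitian)
    (i : Fin (Fintype.card V)) : hA.eigenvalues (eigenIndex V i) = hA.eigenvalues₀ i := by
  simp [Matrix.IsHermitian.eigenvalues, eigenIndex]

theorem eigenvectorBasis_dotProduct_mulVec {A : Matrix V V ℝ} (hA : A.IsHermitian) (i : V) :
    (hA.eigenvectorBasis i).ofLp ⬝ᵥ A.mulVec (hA.eigenvectorBasis i).ofLp = hA.eigenvalues i := by
  rw [hA.mulVec_eigenvectorBasis, dotProduct_smul, ofLp_dotProduct_self]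
  simp

/-- Two distinct members of an orthonormal basis are not both constant vectors. -/
theorem not_const_of_orthonormalBasis (b : OrthonormalBasis V ℝ (EuclideanSpace ℝ V)) {i j : V}
    (hij : i ≠ j) (hi : ∀ k l, (b i).ofLp k = (b i).ofLp l)
    (hj : ∀ k l, (b j).ofLp k = (b j).ofLp l) : False := by
  have h0 : (b i).ofLp ⬝ᵥ (b j).ofLp = 0 := by
    rw [← inner_eq_ofLp_dotProduct]; exact b.orthonormal.2 hij
  have hne : ∀ m : V, (∀ k l, (b m).ofLp k = (b m).ofLp l) → (b m).ofLp i ≠ 0 := by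
    intro m hm h
    have h1 : (b m).ofLp ⬝ᵥ (b m).ofLp = 1 := by rw [ofLp_dotProduct_self]; simp
    simp [dotProduct, fun k => (hm k i).trans h] at h1
  have h2 : (b i).ofLp ⬝ᵥ (b j).ofLp =
      (Fintype.card V : ℝ) * ((b i).ofLp i * (b j).ofLp i) := by
    simp only [dotProduct, fun k => hi k i, fun k => hj k i, Finset.sum_const, Finset.card_univ,
      nsmul_eq_mul]
  rw [h2] at h0
  have hn : (Fintype.card V : ℝ) ≠ 0 := by exact_mod_cast Fintype.card_ne_zero
  exact mul_ne_zero hn (mul_ne_zero (hne i hi) (hne j hj)) h0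

/-- Otherwise the eigenvectors of the two smallest eigenvalues would both have zero Dirichlet
energy, hence be constant by connectedness, yet be orthonormal. -/
theorem IsEdgeDistribution.spectralGap_pos (hp : IsEdgeDistribution G p) (hG : G.Connected) :
    0 < spectralGap p := by
  by_contra hc
  have hcard := Fintype.one_lt_card (α := V)
  have hA := laplacian_isHermitian p
  have key : ∀ i : Fin (Fintype.card V), Fintype.card V - 2 ≤ i.1 → ∀ k l,
      (hA.eigenvectorBasis (eigenIndex V i)).ofLp k =
        (hA.eigenvectorBasis (eigenIndex V i)).ofLp l := by
    intro i hi
    apply hp.eq_of_dotProduct_laplacian_mulVec_nonpos hG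
    rw [eigenvectorBasis_dotProduct_mulVec, eigenvalues_eigenIndex]
    exact (hA.eigenvalues₀_antitone (Fin.mk_le_of_le_val hi)).trans (not_lt.1 hc)
  refine not_const_of_orthonormalBasis hA.eigenvectorBasis
    (i := eigenIndex V ⟨Fintype.card V - 2, by omega⟩)
    (j := eigenIndex V ⟨Fintype.card V - 1, by omega⟩) ?_ (key _ ?_) (key _ ?_)
  · simp; omega
  · simp
  · simp; omega

theorem IsEdgeDistribution.lambdaTwo_lt_one (hp : IsEdgeDistribution G p) (hG : G.Connected) :
    lambdaTwo p < 1 := by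
  by_contra hc
  have hcard := Fintype.one_lt_card (α := V)
  have hA := meanAveragingMatrix_isHermitian p
  have key : ∀ i : Fin (Fintype.card V), i.1 ≤ 1 → ∀ k l,
      (hA.eigenvectorBasis (eigenIndex V i)).ofLp k =
        (hA.eigenvectorBasis (eigenIndex V i)).ofLp l := by
    intro i hi
    apply hp.eq_of_dotProduct_laplacian_mulVec_nonpos hG
    have h := eigenvectorBasis_dotProduct_mulVec hA (eigenIndex V i)
    rw [eigenvalues_eigenIndex, hp.meanAveragingMatrix_mulVec, dotProduct_sub, dotProduct_smul,
      ofLp_dotProduct_self] at h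
    simp only [OrthonormalBasis.norm_eq_one, smul_eq_mul] at h
    have h2 : lambdaTwo p ≤ hA.eigenvalues₀ i := hA.eigenvalues₀_antitone (Fin.le_def.2 hi)
    linarith
  refine not_const_of_orthonormalBasis hA.eigenvectorBasis
    (i := eigenIndex V ⟨0, by omega⟩) (j := eigenIndex V ⟨1, by omega⟩) ?_ (key _ ?_) (key _ ?_)
  · simp
  · simp
  · simp

/-- Poincaré inequality for the weighted Laplacian. -/
theorem IsEdgeDistribution.spectralGap_mul_le (hp : IsEdgeDistribution G p) (hG : G.Connected)
    (x : V → ℝ) (hx : ∑ k, x k = 0) :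
    spectralGap p * (x ⬝ᵥ x) ≤ x ⬝ᵥ (laplacian p).mulVec x := by
  have hcard := Fintype.one_lt_card (α := V)
  have hA := laplacian_isHermitian p
  -- Apply the bound to `-L`: the vector `1` has eigenvalue `0` and all other eigenvalues are at
  -- most `-c < 0`.
  have h := dotProduct_mulVec_le_of_orthonormalBasis (-laplacian p) hA.eigenvectorBasis
    (fun i => -hA.eigenvalues i) (fun i => by
      rw [Matrix.neg_mulVec, hA.mulVec_eigenvectorBasis, neg_smul]) (θ := 0) (κ := -spectralGap p)
    hA.neg (by rw [Matrix.neg_mulVec, laplacian_mulVec_const]; simp)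
    (eigenIndex V ⟨Fintype.card V - 1, by omega⟩) ?_
    (by have := hp.spectralGap_pos hG; linarith) x hx
  · rw [Matrix.neg_mulVec, dotProduct_neg] at h
    linarith
  · intro i hi
    obtain ⟨j, rfl⟩ := (eigenIndex V).surjective i
    rw [eigenvalues_eigenIndex]
    refine neg_le_neg (hA.eigenvalues₀_antitone (Fin.le_def.2 ?_))
    have hj : j.1 ≠ Fintype.card V - 1 := fun h => hi (congrArg _ (Fin.ext h))
    have := j.2
    simp only
    omega

theorem IsEdgeDistribution.dotProduct_meanAveragingMatrix_le (hp : IsEdgeDistribution G p)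
    (hG : G.Connected) (x : V → ℝ) (hx : ∑ k, x k = 0) :
    x ⬝ᵥ (meanAveragingMatrix p).mulVec x ≤ lambdaTwo p * (x ⬝ᵥ x) := by
  have hcard := Fintype.one_lt_card (α := V)
  have hA := meanAveragingMatrix_isHermitian p
  refine dotProduct_mulVec_le_of_orthonormalBasis _ hA.eigenvectorBasis hA.eigenvalues
    hA.mulVec_eigenvectorBasis (θ := 1) hA
    (by rw [hp.meanAveragingMatrix_mulVec, laplacian_mulVec_const]; simp)
    (eigenIndex V ⟨0, by omega⟩) ?_ (hp.lambdaTwo_lt_one hG) x hx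
  intro i hi
  obtain ⟨j, rfl⟩ := (eigenIndex V).surjective i
  rw [eigenvalues_eigenIndex]
  refine hA.eigenvalues₀_antitone (Fin.le_def.2 ?_)
  have hj : j.1 ≠ 0 := fun h => hi (congrArg _ (Fin.ext h))
  simp only
  omega

/-- A mean of orthogonal projections is positive semidefinite. This makes `√λ₂(2)` a genuine square
root and, through `I - L / 2 ≥ 0`, forces `c ≤ 2`. -/
theorem IsEdgeDistribution.dotProduct_meanAveragingMatrix_nonneg (hp : IsEdgeDistribution G p)
    (x : V → ℝ) : 0 ≤ x ⬝ᵥ (meanAveragingMatrix p).mulVec x := by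
  rw [GoTrim.meanAveragingMatrix_mulVec, dotProduct_sum]
  refine Finset.sum_nonneg fun e _ => ?_
  rw [dotProduct_smul, ← averagingMatrix_mulVec_dotProduct_self]
  exact mul_nonneg (hp.nonneg e) (Finset.sum_nonneg fun k _ => mul_self_nonneg _)

theorem IsEdgeDistribution.lambdaTwo_nonneg (hp : IsEdgeDistribution G p) :
    0 ≤ lambdaTwo p := by
  have hA := meanAveragingMatrix_isHermitian p
  have h := eigenvectorBasis_dotProduct_mulVec hA (eigenIndex V ⟨1, Fintype.one_lt_card⟩)
  rw [eigenvalues_eigenIndex] at h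
  exact (hp.dotProduct_meanAveragingMatrix_nonneg _).trans_eq h

theorem IsEdgeDistribution.spectralGap_le_two (hp : IsEdgeDistribution G p) :
    spectralGap p ≤ 2 := by
  have hA := laplacian_isHermitian p
  have hcard := Fintype.one_lt_card (α := V)
  set x := (hA.eigenvectorBasis (eigenIndex V ⟨Fintype.card V - 2, by omega⟩)).ofLp with hx
  have h : x ⬝ᵥ (laplacian p).mulVec x = spectralGap p := by
    rw [hx, eigenvectorBasis_dotProduct_mulVec, eigenvalues_eigenIndex]; rfl
  have h1 : x ⬝ᵥ x = 1 := by rw [hx, ofLp_dotProduct_self]; simp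
  have h2 := hp.dotProduct_meanAveragingMatrix_nonneg x
  rw [hp.meanAveragingMatrix_mulVec, dotProduct_sub, dotProduct_smul, h, h1, smul_eq_mul] at h2
  linarith

theorem IsEdgeDistribution.cTilde_pos (hp : IsEdgeDistribution G p) (hG : G.Connected) :
    0 < cTilde p := by
  have h : √(lambdaTwo p) < 1 := by
    rw [Real.sqrt_lt' one_pos]; simpa using hp.lambdaTwo_lt_one hG
  rw [cTilde]; linarith

theorem cTilde_le_one (p : Sym2 V → ℝ) : cTilde p ≤ 1 := by
  rw [cTilde]; linarith [Real.sqrt_nonneg (lambdaTwo p)]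

/-- Partial sums of the orbit of a centred vector under the mean swap stay bounded. -/
theorem IsEdgeDistribution.sum_orbit_le (hp : IsEdgeDistribution G p) (hG : G.Connected)
    (f : ℕ → V → ℝ) (h0 : ∑ k, f 0 k = 0)
    (hf : ∀ d, f (d + 1) = f d - (laplacian p).mulVec (f d)) {B : ℝ} (hB0 : 0 ≤ B)
    (hB : f 0 ⬝ᵥ f 0 ≤ B ^ 2) (D : ℕ) (k : V) :
    ∑ d ∈ Finset.range D, f d k ≤ 2 * B / spectralGap p := by
  have hc := hp.spectralGap_pos hG
  have hmean : ∀ d, ∑ k, f d k = 0 := by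
    intro d
    induction d with
    | zero => exact h0
    | succ d ih => simp [hf, ih, sum_laplacian_mulVec]
  have hnorm : ∀ d, f d ⬝ᵥ f d ≤ B ^ 2 := by
    intro d
    induction d with
    | zero => exact hB
    | succ d ih => rw [hf]; exact (hp.dotProduct_self_sub_laplacian_le _).trans ih
  set g : V → ℝ := ∑ d ∈ Finset.range D, f d with hg
  -- Telescoping: `L f_d = f_d - f_{d+1}`.
  have hLg : (laplacian p).mulVec g = f 0 - f D := by
    rw [hg]
    clear hg
    clear g
    induction D with
    | zero => simp
    | succ D ih => rw [Finset.sum_range_succ, Matrix.mulVec_add, ih, hf D]; abel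
  have hgm : ∑ k, g k = 0 := by
    simp only [hg, Finset.sum_apply]
    rw [Finset.sum_comm]
    simp [hmean]
  have hP := hp.spectralGap_mul_le hG g hgm
  rw [hLg] at hP
  -- Cauchy–Schwarz with `‖f_0 - f_D‖ ≤ 2B`; against the Poincaré bound `c ‖g‖² ≤ ⟨g, f_0 - f_D⟩` it
  -- yields `‖g‖ ≤ 2B / c`.
  have hCS : (g ⬝ᵥ (f 0 - f D)) ^ 2 ≤ (g ⬝ᵥ g) * (2 * B) ^ 2 := by
    have h1 : (g ⬝ᵥ (f 0 - f D)) ^ 2 ≤ (g ⬝ᵥ g) * ((f 0 - f D) ⬝ᵥ (f 0 - f D)) := by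
      simp only [dotProduct, ← sq]
      exact Finset.sum_mul_sq_le_sq_mul_sq _ _ _
    have h2 : (f 0 - f D) ⬝ᵥ (f 0 - f D) ≤ (2 * B) ^ 2 := by
      have h3 : 0 ≤ (f 0 + f D) ⬝ᵥ (f 0 + f D) := Finset.sum_nonneg fun k _ => mul_self_nonneg _
      have := hnorm 0
      have := hnorm D
      simp only [add_dotProduct, dotProduct_add, sub_dotProduct, dotProduct_sub] at *
      nlinarith
    exact h1.trans (mul_le_mul_of_nonneg_left h2 (Finset.sum_nonneg fun k _ => mul_self_nonneg _))
  have hgg : 0 ≤ g ⬝ᵥ g := Finset.sum_nonneg fun k _ => mul_self_nonneg _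
  have hgB : (g ⬝ᵥ g) ≤ (2 * B / spectralGap p) ^ 2 := by
    rw [div_pow, le_div_iff₀ (by positivity)]
    rcases hgg.eq_or_lt with h | h
    · rw [← h]; simp; positivity
    · have h3 : (spectralGap p * (g ⬝ᵥ g)) ^ 2 ≤ (g ⬝ᵥ g) * (2 * B) ^ 2 :=
        (pow_le_pow_left₀ (by positivity) hP 2).trans hCS
      refine le_of_mul_le_mul_left ?_ h
      linarith
  have hk : g k ^ 2 ≤ g ⬝ᵥ g := by
    rw [sq]
    exact Finset.single_le_sum (f := fun k => g k * g k) (fun i _ => mul_self_nonneg _)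
      (Finset.mem_univ k)
  have h5 := (le_abs_self _).trans (abs_le_of_sq_le_sq (hk.trans hgB) (by positivity))
  rwa [hg, Finset.sum_apply] at h5

end Spectral

/-! ### Expectations along the random edges -/

/-- A function of finitely many edges lives on a finite set, so its measurability and boundedness
are automatic and independence of coordinate blocks applies to it. -/
theorem exists_comp_of_dependsOn {α : Type*} {t : ℕ} {F : (ℕ → α) → ℝ}
    (hF : DependsOn F (Set.Iic t)) :
    ∃ g : (Finset.Iic t → α) → ℝ, ∀ x, F x = g (fun i => x i) :=
  ⟨fun y => F fun i => y ⟨min i t, by simp⟩, fun x => hF fun i hi => by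
    simp [min_eq_left (Set.mem_Iic.1 hi)]⟩

section Expectation

variable {Ω : Type*} [MeasurableSpace Ω] {μ : Measure Ω} [IsProbabilityMeasure μ]
  {p : Sym2 V → ℝ} {ξ : ℕ → Ω → Sym2 V}

theorem IsEdgeSampling.integrable (h : IsEdgeSampling μ p ξ) {t : ℕ} {F : (ℕ → Sym2 V) → ℝ}
    (hF : DependsOn F (Set.Iic t)) : Integrable (fun ω => F (fun s => ξ s ω)) μ := by
  obtain ⟨g, hg⟩ := exists_comp_of_dependsOn hF
  let _ : MeasurableSpace (Sym2 V) := ⊤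
  have : MeasurableSingletonClass (Sym2 V) := ⟨fun _ => trivial⟩
  have hm : Measurable (fun ω => g (fun i : Finset.Iic t => ξ i ω)) :=
    (measurable_of_countable g).comp (measurable_pi_lambda _ fun i => h.measurable i)
  simp only [hg]
  obtain ⟨C, hC⟩ := Finite.exists_le (fun y => ‖g y‖)
  exact Integrable.of_bound hm.aestronglyMeasurable C (ae_of_all _ fun ω => hC _)

theorem IsEdgeSampling.integral_indicator_mul (h : IsEdgeSampling μ p ξ) {t : ℕ}
    {F : (ℕ → Sym2 V) → ℝ} (hF : DependsOn F (Set.Iic t)) (e : Sym2 V) :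
    ∫ ω, (if ξ (t + 1) ω = e then 1 else 0) * F (fun s => ξ s ω) ∂μ =
      p e * ∫ ω, F (fun s => ξ s ω) ∂μ := by
  obtain ⟨g, hg⟩ := exists_comp_of_dependsOn hF
  let _ : MeasurableSpace (Sym2 V) := ⊤
  have : MeasurableSingletonClass (Sym2 V) := ⟨fun _ => trivial⟩
  have hind := h.indep.indepFun_finset {t + 1} (Finset.Iic t) (by simp) h.measurable
  simp only [hg]
  have hm : ∀ S : Finset ℕ, Measurable (fun ω (i : S) => ξ i ω) :=
    fun S => measurable_pi_lambda _ fun i => h.measurable i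
  have hT : t + 1 ∈ ({t + 1} : Finset ℕ) := by simp
  have key := hind.integral_fun_comp_mul_comp (𝕜 := ℝ)
    (f := fun y => if y ⟨t + 1, hT⟩ = e then (1 : ℝ) else 0) (g := g)
    (hm _).aemeasurable (hm _).aemeasurable
    (measurable_of_countable _).aestronglyMeasurable
    (measurable_of_countable _).aestronglyMeasurable
  rw [key]
  congr 1
  rw [← h.law (t + 1) e, ← integral_indicator_one (h.measurable (t + 1) trivial)]
  refine integral_congr_ae (ae_of_all _ fun ω => ?_)
  by_cases he : ξ (t + 1) ω = e <;> simp [he]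

/-- The edge drawn at time `t + 1` is independent of the first `t` edges. -/
theorem IsEdgeSampling.integral_step (h : IsEdgeSampling μ p ξ) (t : ℕ)
    (F : (ℕ → Sym2 V) → Sym2 V → ℝ) (hF : ∀ e, DependsOn (fun x => F x e) (Set.Iic t)) :
    ∫ ω, F (fun s => ξ s ω) (ξ (t + 1) ω) ∂μ =
      ∑ e, p e * ∫ ω, F (fun s => ξ s ω) e ∂μ := by
  have h1 : ∀ ω, F (fun s => ξ s ω) (ξ (t + 1) ω) =
      ∑ e, (if ξ (t + 1) ω = e then 1 else 0) * F (fun s => ξ s ω) e := by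
    intro ω; simp
  simp only [h1]
  rw [integral_finsetSum]
  · exact Finset.sum_congr rfl fun e _ => h.integral_indicator_mul (hF e) e
  · intro e _
    refine h.integrable (t := t + 1) (F := fun x => (if x (t + 1) = e then 1 else 0) * F x e) ?_
    intro x y hxy
    have := (hF e).mono (Set.Iic_subset_Iic.2 t.le_succ) hxy
    simp only [this, hxy (t + 1) (Set.mem_Iic.2 le_rfl)]

theorem sq_integral_le {f : Ω → ℝ} (hf : Integrable f μ) (hf2 : Integrable (fun ω => f ω ^ 2) μ) :
    (∫ ω, f ω ∂μ) ^ 2 ≤ ∫ ω, f ω ^ 2 ∂μ := by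
  set m := ∫ ω, f ω ∂μ with hm
  have h : 0 ≤ ∫ ω, (f ω - m) ^ 2 ∂μ := integral_nonneg fun ω => sq_nonneg _
  have e : ∫ ω, (f ω - m) ^ 2 ∂μ = (∫ ω, f ω ^ 2 ∂μ) - 2 * m * m + m ^ 2 := by
    have : ∀ ω, (f ω - m) ^ 2 = f ω ^ 2 - 2 * m * f ω + m ^ 2 := fun ω => by ring
    simp only [this]
    rw [integral_add (f := fun ω => f ω ^ 2 - 2 * m * f ω) (hf2.sub (hf.const_mul _))
      (integrable_const _), integral_sub hf2 (hf.const_mul _), integral_const_mul, ← hm]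
    simp
  rw [e] at h
  linarith

theorem integral_le_of_sq {f : Ω → ℝ} (hf : Integrable f μ)
    (hf2 : Integrable (fun ω => f ω ^ 2) μ) {y : ℝ} (hy : 0 ≤ y)
    (h : ∫ ω, f ω ^ 2 ∂μ ≤ y ^ 2) : ∫ ω, f ω ∂μ ≤ y :=
  le_of_abs_le (abs_le_of_sq_le_sq ((sq_integral_le hf hf2).trans h) hy)

/-- Minkowski's inequality for random vectors. -/
theorem integral_dotProduct_self_add_le {f g : Ω → V → ℝ}
    (hf : Integrable (fun ω => f ω ⬝ᵥ f ω) μ) (hg : Integrable (fun ω => g ω ⬝ᵥ g ω) μ)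
    {x y : ℝ} (hx0 : 0 ≤ x) (hy0 : 0 ≤ y) (hx : ∫ ω, f ω ⬝ᵥ f ω ∂μ ≤ x ^ 2)
    (hy : ∫ ω, g ω ⬝ᵥ g ω ∂μ ≤ y ^ 2) :
    ∫ ω, (f ω + g ω) ⬝ᵥ (f ω + g ω) ∂μ ≤ (x + y) ^ 2 := by
  -- Weighted Young inequality, optimal when the two norms are `a` and `b`. The weights need `a, b >
  -- 0`; zero bounds are reached by letting `ε → 0` below.
  have main : ∀ a b : ℝ, 0 < a → 0 < b → x ≤ a → y ≤ b →
      ∫ ω, (f ω + g ω) ⬝ᵥ (f ω + g ω) ∂μ ≤ (a + b) ^ 2 := by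
    intro a b ha hb hxa hyb
    have hpt : ∀ ω, (f ω + g ω) ⬝ᵥ (f ω + g ω) ≤
        (1 + b / a) * (f ω ⬝ᵥ f ω) + (1 + a / b) * (g ω ⬝ᵥ g ω) := by
      intro ω
      simp only [dotProduct, Finset.mul_sum, ← Finset.sum_add_distrib]
      refine Finset.sum_le_sum fun k _ => ?_
      simp only [Pi.add_apply]
      have : (1 + b / a) * (f ω k * f ω k) + (1 + a / b) * (g ω k * g ω k) -
          (f ω k + g ω k) * (f ω k + g ω k) = (b * f ω k - a * g ω k) ^ 2 / (a * b) := by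
        field_simp; ring
      have h0 : 0 ≤ (b * f ω k - a * g ω k) ^ 2 / (a * b) := by positivity
      linarith
    have h1 : ∫ ω, (f ω + g ω) ⬝ᵥ (f ω + g ω) ∂μ ≤
        (1 + b / a) * (∫ ω, f ω ⬝ᵥ f ω ∂μ) + (1 + a / b) * (∫ ω, g ω ⬝ᵥ g ω ∂μ) := by
      rw [← integral_const_mul, ← integral_const_mul,
        ← integral_add (hf.const_mul _) (hg.const_mul _)]
      exact integral_mono_of_nonneg
        (ae_of_all _ fun ω => Finset.sum_nonneg fun k _ => mul_self_nonneg _)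
        ((hf.const_mul _).add (hg.const_mul _)) (ae_of_all _ hpt)
    have hfa : ∫ ω, f ω ⬝ᵥ f ω ∂μ ≤ a ^ 2 := hx.trans (pow_le_pow_left₀ hx0 hxa 2)
    have hgb : ∫ ω, g ω ⬝ᵥ g ω ∂μ ≤ b ^ 2 := hy.trans (pow_le_pow_left₀ hy0 hyb 2)
    calc _ ≤ _ := h1
      _ ≤ (1 + b / a) * a ^ 2 + (1 + a / b) * b ^ 2 := by gcongr
      _ = (a + b) ^ 2 := by field_simp; ring
  have hlim : Filter.Tendsto (fun ε : ℝ => (x + ε + (y + ε)) ^ 2) (nhdsWithin 0 (Set.Ioi 0))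
      (nhds ((x + 0 + (y + 0)) ^ 2)) :=
    (Continuous.tendsto (by fun_prop) 0).mono_left nhdsWithin_le_nhds
  simp only [add_zero] at hlim
  refine ge_of_tendsto hlim ?_
  filter_upwards [self_mem_nhdsWithin] with ε hε
  have hε' : 0 < ε := hε
  exact main _ _ (by linarith) (by linarith) (by linarith) (by linarith)

end Expectation

/-! ### Dependence on the past -/

theorem auxObs_dependsOn (X : V → ℝ) (t : ℕ) :
    DependsOn (fun e : ℕ → Sym2 V => auxObs X e t) (Set.Iic t) := by
  intro x y hxy
  induction t with
  | zero => rfl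
  | succ t ih =>
    have h := ih fun i hi => hxy i (Set.Iic_subset_Iic.2 t.le_succ hi)
    simp only at h
    simp only [auxObs, h, hxy (t + 1) (Set.mem_Iic.2 le_rfl)]

theorem normRankEst_succ (X : V → ℝ) (e : ℕ → Sym2 V) (t : ℕ) (k : V) :
    normRankEst X e (t + 1) k = (1 - 1 / ((t + 1 : ℕ) : ℝ)) * normRankEst X e t k +
      1 / ((t + 1 : ℕ) : ℝ) * (if auxObs X e t k < X k then 1 else 0) := by
  rw [normRankEst]

/-- The estimate at time `t + 1` reads `Y(t)`, hence only the first `t` edges. This shift makes the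
injection at iteration `t + 1` independent of the edge drawn there. -/
theorem normRankEst_dependsOn (X : V → ℝ) (t : ℕ) :
    DependsOn (fun e : ℕ → Sym2 V => normRankEst X e (t + 1)) (Set.Iic t) := by
  intro x y hxy
  induction t with
  | zero => rfl
  | succ t ih =>
    have h := ih fun i hi => hxy i (Set.Iic_subset_Iic.2 t.le_succ hi)
    have h2 := auxObs_dependsOn X (t + 1) hxy
    simp only at h h2
    funext k
    simp only [normRankEst_succ _ _ (t + 1), h, h2]

theorem weight_dependsOn (α : ℝ) (X : V → ℝ) (t : ℕ) :
    DependsOn (fun e : ℕ → Sym2 V => weight α X e (t + 1)) (Set.Iic t) := by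
  intro x y hxy
  have h := normRankEst_dependsOn X t hxy
  simp only at h
  simp only [weight, rankEst, h]

theorem weight_dependsOn_self (α : ℝ) (X : V → ℝ) (t : ℕ) :
    DependsOn (fun e : ℕ → Sym2 V => weight α X e t) (Set.Iic t) := by
  cases t with
  | zero => intro x y _; rfl
  | succ t => exact (weight_dependsOn α X t).mono (Set.Iic_subset_Iic.2 t.le_succ)

theorem estimate_dependsOn (α : ℝ) (X : V → ℝ) (t : ℕ) :
    DependsOn (fun e : ℕ → Sym2 V => estimate α X e t) (Set.Iic t) := by
  intro x y hxy
  induction t with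
  | zero => rfl
  | succ t ih =>
    have hxy' : ∀ i ∈ Set.Iic t, x i = y i :=
      fun i hi => hxy i (Set.Iic_subset_Iic.2 t.le_succ hi)
    have h1 := ih hxy'
    have h2 := weight_dependsOn α X t hxy'
    have h3 := weight_dependsOn_self α X t hxy'
    simp only at h1 h2 h3
    simp only [estimate, h1, h2, h3, hxy (t + 1) (Set.mem_Iic.2 le_rfl)]

/-! ### Accuracy of the rank estimates -/

/-- The normalized rank `u_k = (r_k - 1) / n`. -/
noncomputable def normRank (X : V → ℝ) (k : V) : ℝ :=
  ((rank X k : ℝ) - 1) / (Fintype.card V : ℝ)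

/-- The outcome, at every node, of comparing its auxiliary observation with `X k`, centred. -/
noncomputable def comparison (X : V → ℝ) (k : V) (e : ℕ → Sym2 V) (s : ℕ) (l : V) : ℝ :=
  (if auxObs X e s l < X k then 1 else 0) - normRank X k

theorem comparison_succ (X : V → ℝ) (k : V) (e : ℕ → Sym2 V) (s : ℕ) (l : V) :
    comparison X k e (s + 1) l = comparison X k e s (swapEdge (e (s + 1)) l) := rfl

theorem comparison_dependsOn (X : V → ℝ) (k : V) (s : ℕ) :
    DependsOn (fun e : ℕ → Sym2 V => comparison X k e s) (Set.Iic s) := by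
  intro x y hxy
  have h := auxObs_dependsOn X s hxy
  simp only at h
  funext l
  simp only [comparison, h]

/-- `Y(s)` is a permutation of `X`, so symmetric functions of the comparisons are constant in time.
-/
theorem sum_comp_comparison (X : V → ℝ) (k : V) (e : ℕ → Sym2 V) (s : ℕ) (g : ℝ → ℝ) :
    ∑ l, g (comparison X k e s l) = ∑ l, g (comparison X k e 0 l) := by
  induction s with
  | zero => rfl
  | succ s ih =>
    simp only [comparison_succ]
    rw [Equiv.sum_comp (swapEdge (e (s + 1))) (fun l => g (comparison X k e s l)), ih]

theorem comparison_zero (X : V → ℝ) (k : V) (e : ℕ → Sym2 V) (l : V) :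
    comparison X k e 0 l = (if X l < X k then 1 else 0) - normRank X k := rfl

theorem sum_ite_lt [Nonempty V] (X : V → ℝ) (k : V) :
    ∑ l, (if X l < X k then (1 : ℝ) else 0) = (Fintype.card V : ℝ) * normRank X k := by
  have hn : (Fintype.card V : ℝ) ≠ 0 := by exact_mod_cast Fintype.card_ne_zero
  rw [Finset.sum_boole, normRank, rank]
  push_cast
  field_simp
  ring

theorem sum_comparison [Nonempty V] (X : V → ℝ) (k : V) (e : ℕ → Sym2 V) (s : ℕ) :
    ∑ l, comparison X k e s l = 0 := by
  refine (sum_comp_comparison X k e s fun y => y).trans ?_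
  simp only [comparison_zero, Finset.sum_sub_distrib, sum_ite_lt, Finset.sum_const,
    Finset.card_univ, nsmul_eq_mul, sub_self]

/-- The sum of the squared centred comparisons, `n u_k (1 - u_k)`. -/
theorem comparison_dotProduct_self [Nonempty V] (X : V → ℝ) (k : V) (e : ℕ → Sym2 V) (s : ℕ) :
    comparison X k e s ⬝ᵥ comparison X k e s =
      (Fintype.card V : ℝ) * (normRank X k * (1 - normRank X k)) := by
  rw [dotProduct, sum_comp_comparison X k e s (fun y => y * y)]
  have h : ∀ l, comparison X k e 0 l * comparison X k e 0 l =
      (1 - 2 * normRank X k) * (if X l < X k then (1 : ℝ) else 0) + normRank X k ^ 2 := by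
    intro l
    rw [comparison_zero]
    split_ifs <;> ring
  simp only [h, Finset.sum_add_distrib, ← Finset.mul_sum, sum_ite_lt, Finset.sum_const,
    Finset.card_univ, nsmul_eq_mul]
  ring

theorem mul_normRankEst_sub (X : V → ℝ) (k : V) (e : ℕ → Sym2 V) (t : ℕ) :
    (t : ℝ) * (normRankEst X e t k - normRank X k) =
      ∑ s ∈ Finset.range t, comparison X k e s k := by
  induction t with
  | zero => simp
  | succ t ih =>
    have ht : ((t : ℝ) + 1) ≠ 0 := by positivity
    rw [Finset.sum_range_succ, ← ih, normRankEst_succ, comparison]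
    push_cast
    field_simp
    ring

/-- Expand the square by starting time `s` and lag `d`; doubling counts the diagonal twice, which
only helps the inequality. -/
theorem sq_sum_range_le (a : ℕ → ℝ) (t : ℕ) :
    (∑ s ∈ Finset.range t, a s) ^ 2 ≤
      2 * ∑ s ∈ Finset.range t, ∑ d ∈ Finset.range (t - s), a s * a (s + d) := by
  induction t with
  | zero => simp
  | succ t ih =>
    have h : ∑ s ∈ Finset.range (t + 1), ∑ d ∈ Finset.range (t + 1 - s), a s * a (s + d) =
        ∑ s ∈ Finset.range t, ∑ d ∈ Finset.range (t - s), a s * a (s + d) +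
          (∑ s ∈ Finset.range t, a s) * a t + a t ^ 2 := by
      rw [Finset.sum_range_succ, Finset.sum_mul, ← Finset.sum_add_distrib]
      congr 1
      · refine Finset.sum_congr rfl fun s hs => ?_
        have hs' := Finset.mem_range.1 hs
        rw [Nat.succ_sub hs'.le, Finset.sum_range_succ, Nat.add_sub_cancel' hs'.le]
      · simp [sq]
    rw [h, Finset.sum_range_succ]
    nlinarith [sq_nonneg (a t)]

section Accuracy

variable {Ω : Type*} [MeasurableSpace Ω] {μ : Measure Ω} [IsProbabilityMeasure μ]
  {p : Sym2 V → ℝ} {ξ : ℕ → Ω → Sym2 V} {G : SimpleGraph V} [Nontrivial V]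

/-- With `h_s` the comparison vector, `f_d(l) = E[h_s(k) h_{s+d}(l)]` is an orbit of `I - L`,
because the edge at time `s + d + 1` is independent of the past. It is centred since each `h_s` is,
and Jensen bounds `‖f_0‖` by `n u_k (1 - u_k)`. -/
theorem IsEdgeSampling.sum_integral_comparison_le (h : IsEdgeSampling μ p ξ)
    (hp : IsEdgeDistribution G p) (hG : G.Connected) (X : V → ℝ) (k : V) (s D : ℕ) :
    ∑ d ∈ Finset.range D, ∫ ω, comparison X k (fun i => ξ i ω) s k *
        comparison X k (fun i => ξ i ω) (s + d) k ∂μ ≤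
      2 * ((Fintype.card V : ℝ) * (normRank X k * (1 - normRank X k))) / spectralGap p := by
  set B := (Fintype.card V : ℝ) * (normRank X k * (1 - normRank X k)) with hB
  have hBe : ∀ (e : ℕ → Sym2 V) s, comparison X k e s ⬝ᵥ comparison X k e s = B :=
    comparison_dotProduct_self X k
  have hB0 : 0 ≤ B := by
    rw [← hBe (fun _ => s(k, k)) 0]; exact Finset.sum_nonneg fun l _ => mul_self_nonneg _
  have hdep : ∀ d l l', DependsOn (fun e : ℕ → Sym2 V => comparison X k e s l *
      comparison X k e (s + d) l') (Set.Iic (s + d)) := by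
    intro d l l' x y hxy
    have h1 := comparison_dependsOn X k (s + d) hxy
    have h2 := comparison_dependsOn X k s
      fun i hi => hxy i (Set.Iic_subset_Iic.2 (Nat.le_add_right s d) hi)
    simp only at h1 h2
    simp only [h1, h2]
  refine hp.sum_orbit_le hG (fun d l => ∫ ω, comparison X k (fun i => ξ i ω) s k *
        comparison X k (fun i => ξ i ω) (s + d) l ∂μ) ?_ ?_ hB0 ?_ D k
  · rw [← integral_finsetSum _ fun l _ => h.integrable (hdep 0 k l)]
    simp only [← Finset.mul_sum, add_zero, sum_comparison, mul_zero, integral_zero]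
  · intro d
    funext l
    rw [Pi.sub_apply]
    refine Eq.trans ?_ (hp.sum_mul_comp_swapEdge (fun l => ∫ ω, comparison X k (fun i => ξ i ω) s k *
      comparison X k (fun i => ξ i ω) (s + d) l ∂μ) l)
    exact h.integral_step (s + d) (fun x e => comparison X k x s k *
      comparison X k x (s + d) (swapEdge e l)) fun e => hdep d k _
  · have hsq : ∀ l, Integrable (fun ω => (comparison X k (fun i => ξ i ω) s k *
        comparison X k (fun i => ξ i ω) (s + 0) l) ^ 2) μ := by
      intro l
      refine h.integrable (F := fun x => (comparison X k x s k * comparison X k x (s + 0) l) ^ 2)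
        (t := s) ?_
      intro x y hxy
      have := hdep 0 k l hxy
      simp only at this
      simp only [this]
    calc _ ≤ ∑ l, ∫ ω, (comparison X k (fun i => ξ i ω) s k *
          comparison X k (fun i => ξ i ω) (s + 0) l) ^ 2 ∂μ := by
            refine Finset.sum_le_sum fun l _ => ?_
            rw [← sq]
            exact sq_integral_le (h.integrable (hdep 0 k l)) (hsq l)
      _ = ∫ ω, comparison X k (fun i => ξ i ω) s k ^ 2 * B ∂μ := by
            rw [← integral_finsetSum _ fun l _ => hsq l]
            refine integral_congr_ae (ae_of_all _ fun ω => ?_)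
            simp only [add_zero, mul_pow, ← Finset.mul_sum]
            rw [← hBe (fun i => ξ i ω) s]
            simp [dotProduct, sq]
      _ ≤ ∫ _ω, B ^ 2 ∂μ := by
            refine integral_mono_of_nonneg (ae_of_all _ fun ω => ?_) (integrable_const _)
              (ae_of_all _ fun ω => ?_)
            · exact mul_nonneg (sq_nonneg _) hB0
            · simp only
              rw [sq B]
              refine mul_le_mul_of_nonneg_right ?_ hB0
              rw [← hBe (fun i => ξ i ω) s, sq]
              exact Finset.single_le_sum (f := fun l => comparison X k (fun i => ξ i ω) s l *
                comparison X k (fun i => ξ i ω) s l) (fun i _ => mul_self_nonneg _)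
                (Finset.mem_univ k)
      _ = B ^ 2 := by simp

/-- Mean squared error of the rank estimates. -/
theorem IsEdgeSampling.integral_sq_rankEst_sub_le (h : IsEdgeSampling μ p ξ)
    (hp : IsEdgeDistribution G p) (hG : G.Connected) (X : V → ℝ) (k : V) {t : ℕ} (ht : 0 < t) :
    ∫ ω, (rankEst X (fun i => ξ i ω) t k - rank X k) ^ 2 ∂μ ≤
      4 * rankSigma (Fintype.card V) (rank X k) ^ 2 / (spectralGap p * t) := by
  have hc := hp.spectralGap_pos hG
  have hn : (0 : ℝ) < Fintype.card V := by exact_mod_cast Fintype.card_pos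
  have ht' : (0 : ℝ) < t := by exact_mod_cast ht
  set B := (Fintype.card V : ℝ) * (normRank X k * (1 - normRank X k)) with hB
  have hB0 : 0 ≤ B := by
    rw [hB, ← comparison_dotProduct_self X k (fun _ => s(k, k)) 0]
    exact Finset.sum_nonneg fun l _ => mul_self_nonneg _
  have hσ : rankSigma (Fintype.card V) (rank X k) ^ 2 = (Fintype.card V : ℝ) ^ 2 * B := by
    have h3 : ((Fintype.card V : ℝ) ^ (3 / 2 : ℝ)) ^ 2 = (Fintype.card V : ℝ) ^ 3 := by
      rw [← Real.rpow_natCast, ← Real.rpow_mul hn.le]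
      norm_num
    have h4 : 0 ≤ normRank X k * (1 - normRank X k) := nonneg_of_mul_nonneg_right hB0 hn
    have h5 : score (((rank X k : ℝ) - 1) / (Fintype.card V : ℝ)) ^ 2 =
        normRank X k * (1 - normRank X k) := Real.sq_sqrt h4
    rw [rankSigma, mul_pow, h5, h3, hB]
    ring
  have hdep : ∀ s d, DependsOn (fun e : ℕ → Sym2 V => comparison X k e s k *
      comparison X k e (s + d) k) (Set.Iic (s + d)) := by
    intro s d x y hxy
    have h1 := comparison_dependsOn X k (s + d) hxy
    have h2 := comparison_dependsOn X k s
      fun i hi => hxy i (Set.Iic_subset_Iic.2 (Nat.le_add_right s d) hi)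
    simp only at h1 h2
    simp only [h1, h2]
  have hsum : ∫ ω, (∑ s ∈ Finset.range t, comparison X k (fun i => ξ i ω) s k) ^ 2 ∂μ ≤
      4 * t * B / spectralGap p := by
    have hint : ∀ s d, Integrable (fun ω => comparison X k (fun i => ξ i ω) s k *
        comparison X k (fun i => ξ i ω) (s + d) k) μ := fun s d => h.integrable (hdep s d)
    calc _ ≤ ∫ ω, 2 * ∑ s ∈ Finset.range t, ∑ d ∈ Finset.range (t - s),
          comparison X k (fun i => ξ i ω) s k * comparison X k (fun i => ξ i ω) (s + d) k ∂μ := by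
            refine integral_mono_of_nonneg (ae_of_all _ fun ω => sq_nonneg _) ?_
              (ae_of_all _ fun ω => sq_sum_range_le _ _)
            exact (integrable_finsetSum _ fun s _ => integrable_finsetSum _ fun d _ =>
              hint s d).const_mul 2
      _ = 2 * ∑ s ∈ Finset.range t, ∑ d ∈ Finset.range (t - s),
          ∫ ω, comparison X k (fun i => ξ i ω) s k *
            comparison X k (fun i => ξ i ω) (s + d) k ∂μ := by
            rw [integral_const_mul, integral_finsetSum _ fun s _ => integrable_finsetSum _
              fun d _ => hint s d]
            congr 1
            exact Finset.sum_congr rfl fun s _ => integral_finsetSum _ fun d _ => hint s d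
      _ ≤ 2 * ∑ _s ∈ Finset.range t, 2 * B / spectralGap p := by
            gcongr with s
            exact h.sum_integral_comparison_le hp hG X k s (t - s)
      _ = 4 * t * B / spectralGap p := by
            rw [Finset.sum_const, Finset.card_range, nsmul_eq_mul]; ring
  -- `R - r = n (R' - u)`, and `t (R' - u)` is the sum of the comparisons.
  have hR : ∀ e : ℕ → Sym2 V, (rankEst X e t k - rank X k) ^ 2 =
      ((Fintype.card V : ℝ) ^ 2 / t ^ 2) *
        (∑ s ∈ Finset.range t, comparison X k e s k) ^ 2 := by
    intro e
    rw [← mul_normRankEst_sub, rankEst, normRank]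
    field_simp
    ring
  simp only [hR]
  rw [integral_const_mul, hσ]
  calc _ ≤ (Fintype.card V : ℝ) ^ 2 / t ^ 2 * (4 * t * B / spectralGap p) := by gcongr
    _ = _ := by field_simp

end Accuracy

/-! ### Accuracy of the weights -/

theorem trimCount_le (V : Type*) [Fintype V] {α : ℝ} (hα : 0 < α) :
    (trimCount V α : ℝ) ≤ α * (Fintype.card V : ℝ) :=
  Nat.floor_le (by positivity)

theorem one_sub_two_mul_le_trim [Nonempty V] {α : ℝ} (hα : 0 < α) :
    1 - 2 * α ≤ 1 - 2 * (trimCount V α : ℝ) / (Fintype.card V : ℝ) := by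
  have hn : (0 : ℝ) < Fintype.card V := by exact_mod_cast Fintype.card_pos
  have := trimCount_le V hα
  have h : 2 * (trimCount V α : ℝ) / (Fintype.card V : ℝ) ≤ 2 * α := by
    rw [div_le_iff₀ hn]; linarith
  linarith

theorem abs_sub_half_pos (a b : ℤ) : 0 < |(a : ℝ) - (b + 1 / 2)| := by
  rw [abs_pos]
  intro h
  have h2 : ((2 * a : ℤ) : ℝ) = ((2 * b + 1 : ℤ) : ℝ) := by push_cast; linarith
  have h3 : 2 * a = 2 * b + 1 := by exact_mod_cast h2
  omega

/-- Ranks are integers while both endpoints are half-integers. -/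
theorem gap_pos (α : ℝ) (X : V → ℝ) (k : V) : 0 < gap α X k := by
  refine lt_min ?_ ?_
  · exact_mod_cast abs_sub_half_pos (rank X k) (trimCount V α)
  · have := abs_sub_half_pos (rank X k) ((Fintype.card V : ℤ) - trimCount V α)
    rw [rightEnd]
    push_cast at this
    exact this

/-- The weight of a rank estimate closer to the rank than the gap is exact. -/
theorem weightFun_eq_of_abs_sub_lt {α : ℝ} {X : V → ℝ} {k : V} {R : ℝ}
    (h : |R - rank X k| < gap α X k) : weightFun V α R = weightFun V α (rank X k) := by
  obtain ⟨h1, h2⟩ := abs_lt.1 h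
  have ha : gap α X k ≤ |(rank X k : ℝ) - leftEnd V α| := min_le_left _ _
  have hb : gap α X k ≤ |(rank X k : ℝ) - rightEnd V α| := min_le_right _ _
  have e1 : leftEnd V α ≤ R ↔ leftEnd V α ≤ rank X k := by
    rcases abs_cases ((rank X k : ℝ) - leftEnd V α) with ⟨h3, h4⟩ | ⟨h3, h4⟩ <;>
      constructor <;> intro <;> linarith
  have e2 : R ≤ rightEnd V α ↔ (rank X k : ℝ) ≤ rightEnd V α := by
    rcases abs_cases ((rank X k : ℝ) - rightEnd V α) with ⟨h3, h4⟩ | ⟨h3, h4⟩ <;>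
      constructor <;> intro <;> linarith
  simp only [weightFun, e1, e2]

/-- Within distance `γ_k` of the rank the weight is exact; beyond it, the error is at most `1 / (1 -
2α)` and `|R - r_k| / γ_k ≥ 1`. -/
theorem sq_weightFun_sub_le [Nonempty V] {α : ℝ} (hα : 0 < α) (hα2 : α < 1 / 2) (X : V → ℝ) (k : V)
    (R : ℝ) :
    (weightFun V α R - weightFun V α (rank X k)) ^ 2 ≤
      (1 / (gap α X k * (1 - 2 * α)) ^ 2) * (R - rank X k) ^ 2 := by
  have hg := gap_pos α X k
  have h1 : 0 < 1 - 2 * α := by linarith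
  by_cases h : |R - rank X k| < gap α X k
  · rw [weightFun_eq_of_abs_sub_lt h]
    rw [sub_self, zero_pow two_ne_zero]
    positivity
  · rw [not_lt] at h
    have hw : ∀ r, 0 ≤ weightFun V α r ∧ weightFun V α r ≤ 1 / (1 - 2 * α) := by
      intro r
      have h2 := one_sub_two_mul_le_trim (V := V) hα
      rw [weightFun]
      split_ifs
      · exact ⟨one_div_nonneg.2 (h1.le.trans h2), one_div_le_one_div_of_le h1 h2⟩
      · exact ⟨le_rfl, by positivity⟩
    have h3 : (weightFun V α R - weightFun V α (rank X k)) ^ 2 ≤ (1 / (1 - 2 * α)) ^ 2 := by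
      refine sq_le_sq' ?_ ?_ <;> linarith [hw R, hw (rank X k)]
    have h4 : gap α X k ^ 2 ≤ (R - rank X k) ^ 2 := by
      rw [← sq_abs (R - _)]; exact pow_le_pow_left₀ hg.le h 2
    calc _ ≤ _ := h3
      _ = (1 / (gap α X k * (1 - 2 * α)) ^ 2) * gap α X k ^ 2 := by field_simp
      _ ≤ _ := by gcongr

theorem trimmedMean_eq [Nonempty V] {α : ℝ} (hα : 0 < α) (hα2 : α < 1 / 2) (X : V → ℝ) :
    trimmedMean α X = (∑ k, weightFun V α (rank X k) * X k) / Fintype.card V := by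
  have hn : (0 : ℝ) < Fintype.card V := by exact_mod_cast Fintype.card_pos
  have hpos : 0 < 1 - 2 * (trimCount V α : ℝ) / (Fintype.card V : ℝ) := by
    have := one_sub_two_mul_le_trim (V := V) hα; linarith
  have hpos' : 0 < (Fintype.card V : ℝ) - 2 * trimCount V α := by
    have := mul_pos hn hpos
    field_simp at this
    exact this
  have h : ∀ k, weightFun V α (rank X k) * X k =
      if trimCount V α + 1 ≤ rank X k ∧ rank X k + trimCount V α ≤ Fintype.card V then
        (Fintype.card V / ((Fintype.card V : ℝ) - 2 * trimCount V α)) * X k else 0 := by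
    intro k
    have e1 : leftEnd V α ≤ rank X k ↔ trimCount V α + 1 ≤ rank X k := by
      rw [leftEnd]
      constructor
      · intro h
        by_contra h2
        have h3 : (rank X k : ℝ) ≤ trimCount V α := by exact_mod_cast (by omega)
        linarith
      · intro h
        have h3 : (trimCount V α : ℝ) + 1 ≤ rank X k := by exact_mod_cast h
        linarith
    have e2 : (rank X k : ℝ) ≤ rightEnd V α ↔ rank X k + trimCount V α ≤ Fintype.card V := by
      rw [rightEnd]
      constructor
      · intro h
        by_contra h2
        have h3 : (Fintype.card V : ℝ) + 1 ≤ rank X k + trimCount V α := by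
          exact_mod_cast (by omega)
        linarith
      · intro h
        have h3 : (rank X k : ℝ) + trimCount V α ≤ Fintype.card V := by exact_mod_cast h
        linarith
    simp only [weightFun, e1, e2]
    split_ifs
    · congr 1
      field_simp
    · simp
  simp only [h]
  rw [trimmedMean, ← Finset.sum_filter, ← Finset.mul_sum]
  field_simp

theorem l2norm_sq (v : V → ℝ) : l2norm v ^ 2 = v ⬝ᵥ v := by
  rw [l2norm, ← ofLp_dotProduct_self]

theorem l2norm_nonneg (v : V → ℝ) : 0 ≤ l2norm v := norm_nonneg _

section Weights

variable {Ω : Type*} [MeasurableSpace Ω] {μ : Measure Ω} [IsProbabilityMeasure μ]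
  {p : Sym2 V → ℝ} {ξ : ℕ → Ω → Sym2 V} {G : SimpleGraph V} [Nontrivial V]

/-- The error of the weights, multiplied by the observations. -/
noncomputable def weightError (α : ℝ) (X : V → ℝ) (e : ℕ → Sym2 V) (t : ℕ) (k : V) : ℝ :=
  (weight α X e t k - weightFun V α (rank X k)) * X k

theorem weightError_dependsOn (α : ℝ) (X : V → ℝ) (t : ℕ) :
    DependsOn (fun e : ℕ → Sym2 V => weightError α X e (t + 1)) (Set.Iic t) := by
  intro x y hxy
  have h := weight_dependsOn α X t hxy
  simp only at h
  funext k
  simp only [weightError, h]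

theorem IsEdgeSampling.integral_weightError_le (h : IsEdgeSampling μ p ξ)
    (hp : IsEdgeDistribution G p) (hG : G.Connected) {α : ℝ} (hα : 0 < α) (hα2 : α < 1 / 2)
    (X : V → ℝ) {t : ℕ} (ht : 0 < t) :
    ∫ ω, weightError α X (fun i => ξ i ω) t ⬝ᵥ weightError α X (fun i => ξ i ω) t ∂μ ≤
      (l2norm (fun k => coeffK α X k * X k) / √(spectralGap p * t)) ^ 2 := by
  have hc := hp.spectralGap_pos hG
  have ht' : (0 : ℝ) < t := by exact_mod_cast ht
  obtain ⟨t, rfl⟩ : ∃ s, t = s + 1 := ⟨t - 1, by omega⟩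
  have hint : ∀ k, Integrable (fun ω => weightError α X (fun i => ξ i ω) (t + 1) k *
      weightError α X (fun i => ξ i ω) (t + 1) k) μ := by
    intro k
    refine h.integrable (F := fun x => weightError α X x (t + 1) k * weightError α X x (t + 1) k)
      (t := t) ?_
    intro x y hxy
    have := weightError_dependsOn α X t hxy
    simp only at this
    simp only [this]
  rw [div_pow, Real.sq_sqrt (by positivity), l2norm_sq]
  simp only [dotProduct]
  rw [integral_finsetSum _ fun k _ => hint k, Finset.sum_div]
  refine Finset.sum_le_sum fun k _ => ?_
  have hg := gap_pos α X k
  have h1 : 0 < 1 - 2 * α := by linarith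
  have hint2 : Integrable (fun ω => (rankEst X (fun i => ξ i ω) (t + 1) k - rank X k) ^ 2) μ := by
    refine h.integrable (F := fun x => (rankEst X x (t + 1) k - rank X k) ^ 2) (t := t) ?_
    intro x y hxy
    have := normRankEst_dependsOn X t hxy
    simp only at this
    simp only [rankEst, this]
  calc _ ≤ ∫ ω, (X k ^ 2 / (gap α X k * (1 - 2 * α)) ^ 2) *
        (rankEst X (fun i => ξ i ω) (t + 1) k - rank X k) ^ 2 ∂μ := by
          refine integral_mono (hint k) (hint2.const_mul _) fun ω => ?_
          have := sq_weightFun_sub_le hα hα2 X k (rankEst X (fun i => ξ i ω) (t + 1) k)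
          have h2 := mul_le_mul_of_nonneg_left this (sq_nonneg (X k))
          simp only [weightError, weight]
          calc _ = _ := by ring
            _ ≤ _ := h2
            _ = _ := by ring
    _ ≤ (X k ^ 2 / (gap α X k * (1 - 2 * α)) ^ 2) *
        (4 * rankSigma (Fintype.card V) (rank X k) ^ 2 / (spectralGap p * (t + 1 : ℕ))) := by
          rw [integral_const_mul]
          gcongr
          exact h.integral_sq_rankEst_sub_le hp hG X k ht
    -- The constant `4` is relaxed to the `6` hidden in `K_k`.
    _ ≤ (X k ^ 2 / (gap α X k * (1 - 2 * α)) ^ 2) *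
        (6 * rankSigma (Fintype.card V) (rank X k) ^ 2 / (spectralGap p * (t + 1 : ℕ))) := by
          gcongr
          norm_num
    _ = _ := by
          rw [coeffK]
          have h6 : √6 ^ 2 = (6 : ℝ) := Real.sq_sqrt (by norm_num)
          field_simp
          rw [h6]
          ring

end Weights

/-! ### Consensus -/

/-- Contracting recursion driven by a perturbation of order `1 / √t`. -/
theorem recursion_le {z : ℕ → ℝ} {ρ w A : ℝ} (hρ0 : 0 ≤ ρ) (hρ1 : ρ < 1) (hA : 0 ≤ A)
    (h1 : z 1 ≤ ρ * w) (hz : ∀ t : ℕ, 0 < t → z (t + 1) ≤ ρ * (z t + A / √t)) {t : ℕ}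
    (ht : 0 < t) : z t ≤ ρ ^ t * w + 4 * A / ((1 - ρ) * √t) := by
  set y : ℕ → ℝ := fun t => z t - ρ ^ t * w with hy
  have hy1 : y 1 ≤ 0 := by simp only [hy, pow_one]; linarith
  have hys : ∀ t : ℕ, 0 < t → y (t + 1) ≤ ρ * (y t + A / √t) := by
    intro t ht
    have := hz t ht
    simp only [hy, pow_succ]
    linarith
  -- Bound that ignores the contraction, from `∑ 1/√s ≤ 2√t`; it serves the times before `1 - ρ` has
  -- had effect.
  have htriv : ∀ t : ℕ, y (t + 1) ≤ 2 * A * √t := by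
    intro t
    induction t with
    | zero => simpa using hy1
    | succ t ih =>
      have hpos : (0 : ℝ) < √(t + 1 : ℕ) := Real.sqrt_pos.2 (by positivity)
      have hsq : √(t + 1 : ℕ) ^ 2 = (t : ℝ) + 1 := by
        rw [Real.sq_sqrt (by positivity)]; push_cast; ring
      have hsq' : √(t : ℝ) ^ 2 = (t : ℝ) := Real.sq_sqrt (by positivity)
      have hb : 0 ≤ 2 * A * √t + A / √(t + 1 : ℕ) := by positivity
      have h2 : y (t + 1 + 1) ≤ 2 * A * √t + A / √(t + 1 : ℕ) :=
        calc _ ≤ ρ * (y (t + 1) + A / √(t + 1 : ℕ)) := hys (t + 1) (by omega)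
          _ ≤ ρ * (2 * A * √t + A / √(t + 1 : ℕ)) := by gcongr
          _ ≤ 1 * (2 * A * √t + A / √(t + 1 : ℕ)) := by gcongr
          _ = _ := one_mul _
      refine h2.trans ?_
      have h3 : 1 / √(t + 1 : ℕ) ≤ 2 * √(t + 1 : ℕ) - 2 * √t := by
        rw [div_le_iff₀ hpos]
        nlinarith [sq_nonneg (√(t + 1 : ℕ) - √t)]
      have h4 := mul_le_mul_of_nonneg_left h3 hA
      rw [mul_one_div] at h4
      linarith
  have hmain : ∀ t : ℕ, y (t + 1) ≤ 4 * A / ((1 - ρ) * √(t + 1 : ℕ)) := by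
    have hc : 0 < 1 - ρ := by linarith
    intro t
    induction t with
    | zero => exact hy1.trans (by positivity)
    | succ t ih =>
      set a := √(t + 1 : ℕ) with ha
      set b := √(t + 1 + 1 : ℕ) with hb
      have hapos : 0 < a := Real.sqrt_pos.2 (by positivity)
      have hbpos : 0 < b := Real.sqrt_pos.2 (by positivity)
      have ha2 : a ^ 2 = (t : ℝ) + 1 := by
        rw [ha, Real.sq_sqrt (by positivity)]; push_cast; ring
      have hb2 : b ^ 2 = (t : ℝ) + 2 := by
        rw [hb, Real.sq_sqrt (by positivity)]; push_cast; ring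
      -- With `δ = 1 - ρ`: while `δ b² ≤ 2`, the crude bound suffices. Afterwards `δ a² ≥ 1` gives
      -- `b/a ≤ 1 + δ/2`, and the induction closes because `(1 - δ)(4 + δ)(1 + δ/2) ≤ 4`.
      by_cases hlarge : (1 - ρ) * b ^ 2 ≤ 2
      · have hab : a ≤ b := Real.sqrt_le_sqrt (by push_cast; linarith)
        refine (htriv (t + 1)).trans ?_
        rw [le_div_iff₀ (by positivity), ← ha]
        calc 2 * A * a * ((1 - ρ) * b) ≤ 2 * A * b * ((1 - ρ) * b) := by gcongr
          _ = 2 * A * ((1 - ρ) * b ^ 2) := by ring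
          _ ≤ 2 * A * 2 := by gcongr
          _ = 4 * A := by ring
      · rw [not_le] at hlarge
        have hta : 1 ≤ a ^ 2 * (1 - ρ) := by nlinarith
        have hba : b ≤ a * (1 + (1 - ρ) / 2) := by
          refine le_of_sq_le_sq ?_ (by positivity)
          nlinarith [sq_nonneg (a * (1 - ρ))]
        calc _ ≤ ρ * (y (t + 1) + A / a) := hys (t + 1) (by omega)
          _ ≤ ρ * (4 * A / ((1 - ρ) * a) + A / a) := by gcongr
          _ = A * (ρ * (4 + (1 - ρ))) / ((1 - ρ) * a) := by field_simp
          _ ≤ _ := by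
            rw [div_le_div_iff₀ (by positivity) (by positivity)]
            have h5 : ρ * (4 + (1 - ρ)) * b ≤ 4 * a := by
              calc _ ≤ ρ * (4 + (1 - ρ)) * (a * (1 + (1 - ρ) / 2)) := by gcongr
                _ = (ρ * (4 + (1 - ρ)) * (1 + (1 - ρ) / 2)) * a := by ring
                _ ≤ 4 * a := by
                  gcongr
                  nlinarith [mul_nonneg hρ0 hc.le, mul_nonneg (mul_nonneg hρ0 hc.le) hc.le]
            have h6 := mul_le_mul_of_nonneg_left h5 (mul_nonneg hA hc.le)
            calc _ = A * (1 - ρ) * (ρ * (4 + (1 - ρ)) * b) := by ring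
              _ ≤ _ := h6
              _ = _ := by ring
  obtain ⟨s, rfl⟩ : ∃ s, t = s + 1 := ⟨t - 1, by omega⟩
  have := hmain s
  simp only [hy] at this
  linarith

/-- A vector minus its mean. -/
noncomputable def center (v : V → ℝ) (k : V) : ℝ := v k - (∑ l, v l) / Fintype.card V

theorem sum_center [Nonempty V] (v : V → ℝ) : ∑ k, center v k = 0 := by
  have hn : (Fintype.card V : ℝ) ≠ 0 := by exact_mod_cast Fintype.card_ne_zero
  simp only [center, Finset.sum_sub_distrib, Finset.sum_const, Finset.card_univ, nsmul_eq_mul]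
  field_simp
  ring

theorem center_dotProduct_self [Nonempty V] (v : V → ℝ) :
    center v ⬝ᵥ center v = v ⬝ᵥ v - (∑ l, v l) ^ 2 / Fintype.card V := by
  have hn : (Fintype.card V : ℝ) ≠ 0 := by exact_mod_cast Fintype.card_ne_zero
  have h : ∀ k, center v k * center v k = v k * v k - 2 * ((∑ l, v l) / Fintype.card V) * v k +
      ((∑ l, v l) / Fintype.card V) ^ 2 := fun k => by rw [center]; ring
  simp only [dotProduct, h, Finset.sum_add_distrib, Finset.sum_sub_distrib, ← Finset.mul_sum,
    Finset.sum_const, Finset.card_univ, nsmul_eq_mul]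
  field_simp
  ring

theorem center_dotProduct_self_le [Nonempty V] (v : V → ℝ) :
    center v ⬝ᵥ center v ≤ v ⬝ᵥ v := by
  rw [center_dotProduct_self]
  have : 0 ≤ (∑ l, v l) ^ 2 / (Fintype.card V : ℝ) := by positivity
  linarith

theorem mean_dotProduct_self_le [Nonempty V] (v : V → ℝ) :
    (fun _ : V => (∑ l, v l) / (Fintype.card V : ℝ)) ⬝ᵥ
      (fun _ => (∑ l, v l) / (Fintype.card V : ℝ)) ≤ v ⬝ᵥ v := by
  have hn : (Fintype.card V : ℝ) ≠ 0 := by exact_mod_cast Fintype.card_ne_zero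
  have h0 : 0 ≤ center v ⬝ᵥ center v := Finset.sum_nonneg fun k _ => mul_self_nonneg _
  rw [center_dotProduct_self] at h0
  have : (fun _ : V => (∑ l, v l) / (Fintype.card V : ℝ)) ⬝ᵥ
      (fun _ => (∑ l, v l) / (Fintype.card V : ℝ)) = (∑ l, v l) ^ 2 / Fintype.card V := by
    simp only [dotProduct, Finset.sum_const, Finset.card_univ, nsmul_eq_mul]
    field_simp
  linarith

theorem averagingMatrix_mulVec_center (e : Sym2 V) (v : V → ℝ) :
    center ((averagingMatrix e).mulVec v) = (averagingMatrix e).mulVec (center v) := by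
  have h : center v = v - fun _ => (∑ l, v l) / (Fintype.card V : ℝ) := rfl
  rw [h, Matrix.mulVec_sub, averagingMatrix_mulVec_const]
  funext k
  simp only [center, sum_averagingMatrix_mulVec, Pi.sub_apply]

theorem center_add (v w : V → ℝ) : center (v + w) = center v + center w := by
  funext k
  simp only [center, Pi.add_apply, Finset.sum_add_distrib]
  ring

/-- Mass conservation: averaging keeps the sum, and the injected weight changes telescope from `W(0)
= 0`. -/
theorem sum_estimate (α : ℝ) (X : V → ℝ) (e : ℕ → Sym2 V) (t : ℕ) :
    ∑ k, estimate α X e t k = ∑ k, weight α X e t k * X k := by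
  induction t with
  | zero => simp [estimate, weight]
  | succ t ih =>
    rw [estimate, sum_averagingMatrix_mulVec]
    simp only [Pi.add_apply, Pi.mul_apply, Pi.sub_apply, Finset.sum_add_distrib, ih, sub_mul,
      Finset.sum_sub_distrib]
    ring

/-- The amount injected at iteration `t + 1`. -/
noncomputable def increment (α : ℝ) (X : V → ℝ) (e : ℕ → Sym2 V) (t : ℕ) : V → ℝ :=
  (weight α X e (t + 1) - weight α X e t) * X

theorem center_estimate_succ (α : ℝ) (X : V → ℝ) (e : ℕ → Sym2 V) (t : ℕ) :
    center (estimate α X e (t + 1)) = (averagingMatrix (e (t + 1))).mulVec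
      (center (estimate α X e t) + center (increment α X e t)) := by
  rw [estimate, averagingMatrix_mulVec_center, center_add, increment]

theorem increment_dependsOn (α : ℝ) (X : V → ℝ) (t : ℕ) :
    DependsOn (fun e : ℕ → Sym2 V => increment α X e t) (Set.Iic t) := by
  intro x y hxy
  have h2 := weight_dependsOn α X t hxy
  have h3 := weight_dependsOn_self α X t hxy
  simp only at h2 h3
  simp only [increment, h2, h3]

/-- The limiting weight cancels, so rank accuracy alone controls the injections, without studying
how weights jump. -/
theorem increment_eq (α : ℝ) (X : V → ℝ) (e : ℕ → Sym2 V) (t : ℕ) :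
    increment α X e t = weightError α X e (t + 1) + -weightError α X e t := by
  funext k
  simp only [increment, weightError, Pi.mul_apply, Pi.sub_apply, Pi.add_apply, Pi.neg_apply]
  ring

/-- As `Y(0) = X`, each node first compares its value with itself, so `R(1) = 1` everywhere. -/
theorem increment_zero (α : ℝ) (X : V → ℝ) (e : ℕ → Sym2 V) :
    increment α X e 0 = weightFun V α 1 • X := by
  funext k
  simp [increment, weight, rankEst, normRankEst, auxObs]

section Consensus

variable {Ω : Type*} [MeasurableSpace Ω] {μ : Measure Ω} [IsProbabilityMeasure μ]
  {p : Sym2 V → ℝ} {ξ : ℕ → Ω → Sym2 V} {G : SimpleGraph V} [Nontrivial V]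

theorem IsEdgeSampling.integrable_dotProduct_self (h : IsEdgeSampling μ p ξ) {t : ℕ}
    {F : (ℕ → Sym2 V) → V → ℝ} (hF : DependsOn F (Set.Iic t)) :
    Integrable (fun ω => F (fun i => ξ i ω) ⬝ᵥ F (fun i => ξ i ω)) μ := by
  refine h.integrable (F := fun x => F x ⬝ᵥ F x) (t := t) ?_
  intro x y hxy
  simp only [hF hxy]

/-- Averaging over a random edge contracts centred vectors in mean square. -/
theorem IsEdgeSampling.integral_averaging_le (h : IsEdgeSampling μ p ξ)
    (hp : IsEdgeDistribution G p) (hG : G.Connected) {t : ℕ} {F : (ℕ → Sym2 V) → V → ℝ}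
    (hF : DependsOn F (Set.Iic t)) (hF0 : ∀ x, ∑ k, F x k = 0) :
    ∫ ω, (averagingMatrix (ξ (t + 1) ω)).mulVec (F fun i => ξ i ω) ⬝ᵥ
        (averagingMatrix (ξ (t + 1) ω)).mulVec (F fun i => ξ i ω) ∂μ ≤
      lambdaTwo p * ∫ ω, F (fun i => ξ i ω) ⬝ᵥ F (fun i => ξ i ω) ∂μ := by
  -- The projection identity makes the squared norm linear in the matrix, so averaging over the
  -- fresh edge produces the mean matrix.
  simp only [averagingMatrix_mulVec_dotProduct_self]
  have hdep : ∀ e, DependsOn (fun x => F x ⬝ᵥ (averagingMatrix e).mulVec (F x)) (Set.Iic t) := by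
    intro e x y hxy
    simp only [hF hxy]
  rw [h.integral_step t (fun x e => F x ⬝ᵥ (averagingMatrix e).mulVec (F x)) hdep]
  simp only [← integral_const_mul]
  rw [← integral_finsetSum _ fun e _ => (h.integrable (hdep e)).const_mul _]
  refine integral_mono (integrable_finsetSum _ fun e _ => (h.integrable (hdep e)).const_mul _)
    ((h.integrable_dotProduct_self hF).const_mul _) fun ω => ?_
  have := hp.dotProduct_meanAveragingMatrix_le hG (F fun i => ξ i ω) (hF0 _)
  rw [meanAveragingMatrix_mulVec, dotProduct_sum] at this
  simpa only [dotProduct_smul, smul_eq_mul] using this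

theorem IsEdgeSampling.integral_center_estimate_le (h : IsEdgeSampling μ p ξ)
    (hp : IsEdgeDistribution G p) (hG : G.Connected) {α : ℝ} (hα : 0 < α) (hα2 : α < 1 / 2)
    (X : V → ℝ) {t : ℕ} (ht : 0 < t) :
    √(∫ ω, center (estimate α X (fun i => ξ i ω) t) ⬝ᵥ
        center (estimate α X (fun i => ξ i ω) t) ∂μ) ≤
      (1 - cTilde p) ^ t * (weightFun V α 1 * l2norm X) +
        8 * (l2norm (fun k => coeffK α X k * X k) / (cTilde p * √(spectralGap p * t))) := by
  set B := l2norm (fun k => coeffK α X k * X k) with hB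
  have hB0 : 0 ≤ B := l2norm_nonneg _
  have hc := hp.spectralGap_pos hG
  have hct := hp.cTilde_pos hG
  have hρ : 1 - cTilde p = √(lambdaTwo p) := by rw [cTilde]; ring
  have hw0 : 0 ≤ weightFun V α 1 := by
    rw [weightFun]
    split_ifs
    · have := one_sub_two_mul_le_trim (V := V) hα
      exact one_div_nonneg.2 (by linarith)
    · exact le_rfl
  have hdepC : ∀ t, DependsOn (fun e : ℕ → Sym2 V => center (estimate α X e t)) (Set.Iic t) := by
    intro t x y hxy
    have := estimate_dependsOn α X t hxy
    simp only at this
    simp only [this]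
  have hdepI : ∀ t, DependsOn (fun e : ℕ → Sym2 V => center (increment α X e t)) (Set.Iic t) := by
    intro t x y hxy
    have := increment_dependsOn α X t hxy
    simp only at this
    simp only [this]
  have hstep : ∀ (t : ℕ) (η : ℝ), 0 ≤ η →
      ∫ ω, increment α X (fun i => ξ i ω) t ⬝ᵥ increment α X (fun i => ξ i ω) t ∂μ ≤ η ^ 2 →
      √(∫ ω, center (estimate α X (fun i => ξ i ω) (t + 1)) ⬝ᵥ
        center (estimate α X (fun i => ξ i ω) (t + 1)) ∂μ) ≤
      (1 - cTilde p) * (√(∫ ω, center (estimate α X (fun i => ξ i ω) t) ⬝ᵥ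
        center (estimate α X (fun i => ξ i ω) t) ∂μ) + η) := by
    intro t η hη hinc
    have h0 : 0 ≤ ∫ ω, center (estimate α X (fun i => ξ i ω) t) ⬝ᵥ
        center (estimate α X (fun i => ξ i ω) t) ∂μ :=
      integral_nonneg fun ω => Finset.sum_nonneg fun k _ => mul_self_nonneg _
    have hinc' : ∫ ω, center (increment α X (fun i => ξ i ω) t) ⬝ᵥ
        center (increment α X (fun i => ξ i ω) t) ∂μ ≤ η ^ 2 :=
      (integral_mono (h.integrable_dotProduct_self (hdepI t))
        (h.integrable_dotProduct_self (increment_dependsOn α X t))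
        fun ω => center_dotProduct_self_le _).trans hinc
    have hadd := integral_dotProduct_self_add_le (h.integrable_dotProduct_self (hdepC t))
      (h.integrable_dotProduct_self (hdepI t)) (Real.sqrt_nonneg _) hη
      (Real.sq_sqrt h0).ge hinc'
    have hav := h.integral_averaging_le hp hG (t := t)
      (F := fun x => center (estimate α X x t) + center (increment α X x t))
      (fun x y hxy => by
        have h1 := hdepC t hxy
        have h2 := hdepI t hxy
        simp only at h1 h2
        simp only [h1, h2])
      (fun x => by simp only [Pi.add_apply, Finset.sum_add_distrib, sum_center, add_zero])
    rw [hρ]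
    refine Real.sqrt_le_iff.2 ⟨by positivity, ?_⟩
    simp only [center_estimate_succ]
    refine hav.trans ?_
    rw [mul_pow, Real.sq_sqrt hp.lambdaTwo_nonneg]
    exact mul_le_mul_of_nonneg_left hadd hp.lambdaTwo_nonneg
  -- `A = 2B / √c` bounds two weight errors, whence `4A = 8B / √c`; `w` carries the first injection.
  have hrec := recursion_le (z := fun t => √(∫ ω, center (estimate α X (fun i => ξ i ω) t) ⬝ᵥ
        center (estimate α X (fun i => ξ i ω) t) ∂μ)) (ρ := 1 - cTilde p)
      (w := weightFun V α 1 * l2norm X) (A := 2 * B / √(spectralGap p))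
      (by rw [hρ]; positivity) (by linarith) (by positivity) ?_ ?_ ht
  · refine hrec.trans_eq ?_
    rw [sub_sub_cancel, Real.sqrt_mul hc.le]
    have : 0 < √(spectralGap p) := Real.sqrt_pos.2 hc
    have : 0 < √(t : ℝ) := Real.sqrt_pos.2 (by exact_mod_cast ht)
    congr 1
    field_simp
    ring
  · have h0 := hstep 0 (weightFun V α 1 * l2norm X) (mul_nonneg hw0 (l2norm_nonneg X)) (by
      simp only [increment_zero, smul_dotProduct, dotProduct_smul, smul_eq_mul, integral_const,
        probReal_univ, one_mul, mul_pow, l2norm_sq]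
      apply le_of_eq
      ring)
    refine h0.trans_eq ?_
    have hz : center (fun _ : V => (0 : ℝ)) = fun _ => 0 := by funext k; simp [center]
    simp [estimate, hz, dotProduct]
  · intro t ht
    have ht' : (0 : ℝ) < t := by exact_mod_cast ht
    refine hstep t _ (by positivity) ?_
    simp only [increment_eq]
    have e1 := h.integral_weightError_le hp hG hα hα2 X ht
    have e2 := h.integral_weightError_le hp hG hα hα2 X (Nat.succ_pos t)
    have hm : B / √(spectralGap p * (t + 1 : ℕ)) ≤ B / √(spectralGap p * t) := by
      have : 0 < √(spectralGap p * t) := Real.sqrt_pos.2 (by positivity)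
      gcongr
      simp
    have e2' := e2.trans (pow_le_pow_left₀ (by positivity) hm 2)
    have hdepE : DependsOn (fun e : ℕ → Sym2 V => weightError α X e t) (Set.Iic t) := by
      obtain ⟨s, rfl⟩ : ∃ s, t = s + 1 := ⟨t - 1, by omega⟩
      exact (weightError_dependsOn α X s).mono (Set.Iic_subset_Iic.2 s.le_succ)
    have hadd := integral_dotProduct_self_add_le
      (f := fun ω => weightError α X (fun i => ξ i ω) (t + 1))
      (g := fun ω => -weightError α X (fun i => ξ i ω) t)
      (x := B / √(spectralGap p * t)) (y := B / √(spectralGap p * t))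
      (h.integrable_dotProduct_self (weightError_dependsOn α X t))
      (by simpa only [neg_dotProduct_neg] using h.integrable_dotProduct_self hdepE)
      (by positivity) (by positivity) e2' (by simpa only [neg_dotProduct_neg] using e1)
    refine hadd.trans_eq ?_
    rw [Real.sqrt_mul hc.le]
    field_simp
    ring

/-- Mean error of the estimates, up to the contribution of the first injection. -/
theorem IsEdgeSampling.integral_l2norm_estimate_sub_le (h : IsEdgeSampling μ p ξ)
    (hp : IsEdgeDistribution G p) (hG : G.Connected) {α : ℝ} (hα : 0 < α) (hα2 : α < 1 / 2)
    (X : V → ℝ) {t : ℕ} (ht : 0 < t) :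
    ∫ ω, l2norm (fun k => estimate α X (fun i => ξ i ω) t k - trimmedMean α X) ∂μ ≤
      (1 - cTilde p) ^ t * (weightFun V α 1 * l2norm X) +
        9 * (l2norm (fun k => coeffK α X k * X k) / (cTilde p * √(spectralGap p * t))) := by
  have ht' : (0 : ℝ) < t := by exact_mod_cast ht
  set B := l2norm (fun k => coeffK α X k * X k) with hB
  have hB0 : 0 ≤ B := l2norm_nonneg _
  have hc := hp.spectralGap_pos hG
  have hct := hp.cTilde_pos hG
  have hs : 0 < √(spectralGap p * t) := Real.sqrt_pos.2 (by positivity)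
  have hdec : ∀ e : ℕ → Sym2 V, (fun k => estimate α X e t k - trimmedMean α X) =
      center (estimate α X e t) +
        fun _ => (∑ l, weightError α X e t l) / (Fintype.card V : ℝ) := by
    intro e
    funext k
    simp only [Pi.add_apply, center, sum_estimate, trimmedMean_eq hα hα2, weightError, sub_mul,
      Finset.sum_sub_distrib]
    ring
  have hdepE : DependsOn (fun e : ℕ → Sym2 V => estimate α X e t) (Set.Iic t) :=
    estimate_dependsOn α X t
  have hdepC : DependsOn (fun e : ℕ → Sym2 V => center (estimate α X e t)) (Set.Iic t) := by
    intro x y hxy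
    have := hdepE hxy
    simp only at this
    simp only [this]
  have hdepW : DependsOn (fun e : ℕ → Sym2 V => weightError α X e t) (Set.Iic t) := by
    obtain ⟨s, rfl⟩ : ∃ s, t = s + 1 := ⟨t - 1, by omega⟩
    exact (weightError_dependsOn α X s).mono (Set.Iic_subset_Iic.2 s.le_succ)
  have hdepM : DependsOn (fun (e : ℕ → Sym2 V) (_ : V) =>
      (∑ l, weightError α X e t l) / (Fintype.card V : ℝ)) (Set.Iic t) := by
    intro x y hxy
    have := hdepW hxy
    simp only at this
    simp only [this]
  have h0 : 0 ≤ ∫ ω, center (estimate α X (fun i => ξ i ω) t) ⬝ᵥ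
      center (estimate α X (fun i => ξ i ω) t) ∂μ :=
    integral_nonneg fun ω => Finset.sum_nonneg fun k _ => mul_self_nonneg _
  have hM := (integral_mono (h.integrable_dotProduct_self hdepM)
    (h.integrable_dotProduct_self hdepW) fun ω => mean_dotProduct_self_le _).trans
    (h.integral_weightError_le hp hG hα hα2 X ht)
  have hadd := integral_dotProduct_self_add_le (h.integrable_dotProduct_self hdepC)
      (h.integrable_dotProduct_self hdepM) (Real.sqrt_nonneg _) (by positivity)
      (Real.sq_sqrt h0).ge hM
  have hfin := integral_le_of_sq (μ := μ)
    (f := fun ω => l2norm (fun k => estimate α X (fun i => ξ i ω) t k - trimmedMean α X))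
    (h.integrable (F := fun x => l2norm (fun k => estimate α X x t k - trimmedMean α X)) (t := t)
      (fun x y hxy => by
        have := hdepE hxy
        simp only at this
        simp only [this]))
    (h.integrable (F := fun x => l2norm (fun k => estimate α X x t k - trimmedMean α X) ^ 2)
      (t := t) (fun x y hxy => by
        have := hdepE hxy
        simp only at this
        simp only [this]))
    (y := √(∫ ω, center (estimate α X (fun i => ξ i ω) t) ⬝ᵥ
      center (estimate α X (fun i => ξ i ω) t) ∂μ) + B / √(spectralGap p * t))
    (by positivity) (by simpa only [l2norm_sq, hdec] using hadd)
  have hz := h.integral_center_estimate_le hp hG hα hα2 X ht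
  -- The mean part adds one more multiple of the main bound, as `c̃ ≤ 1`: `8 + 1 = 9`.
  have hlast : B / √(spectralGap p * t) ≤ B / (cTilde p * √(spectralGap p * t)) := by
    gcongr
    exact mul_le_of_le_one_left hs.le (cTilde_le_one p)
  linarith

end Consensus

/-! ### The first injection -/

theorem weightFun_one_of_trimCount_pos {α : ℝ} (hm : 1 ≤ trimCount V α) :
    weightFun V α 1 = 0 := by
  rw [weightFun, if_neg]
  rintro ⟨h, -⟩
  have : (1 : ℝ) ≤ trimCount V α := by exact_mod_cast hm
  rw [leftEnd] at h
  linarith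

theorem weightFun_one_le_of_trimCount_eq_zero {α : ℝ} (hm : trimCount V α = 0) :
    weightFun V α 1 ≤ 1 := by
  rw [weightFun]
  split_ifs <;> simp [hm]

/-- With `m = 0` the endpoints no longer depend on `α`. The norm at `α = 0` is then a lower bound
uniform in `α`, which keeps the threshold independent of `α`. -/
theorem coeffK_eq_of_trimCount_eq_zero {α : ℝ} (hm : trimCount V α = 0) (X : V → ℝ) (k : V) :
    coeffK α X k = (1 / (1 - 2 * α)) * coeffK 0 X k := by
  have h0 : trimCount V 0 = 0 := by simp [trimCount]
  have hg : gap α X k = gap 0 X k := by simp only [gap, leftEnd, rightEnd, hm, h0]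
  rw [coeffK, coeffK, hg, mul_zero, sub_zero, mul_one, div_mul_div_comm, one_mul,
    mul_comm (gap 0 X k)]

theorem l2norm_smul (a : ℝ) (v : V → ℝ) : l2norm (fun k => a * v k) = |a| * l2norm v := by
  rw [l2norm, l2norm, ← Real.norm_eq_abs, ← norm_smul]
  rfl

theorem l2norm_coeffK_le_of_trimCount_eq_zero {α : ℝ} (hα : 0 < α) (hα2 : α < 1 / 2)
    (hm : trimCount V α = 0) (X : V → ℝ) :
    l2norm (fun k => coeffK 0 X k * X k) ≤ l2norm (fun k => coeffK α X k * X k) := by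
  simp only [coeffK_eq_of_trimCount_eq_zero hm, mul_assoc]
  rw [l2norm_smul]
  refine le_mul_of_one_le_left (l2norm_nonneg _) ?_
  have h1 : 0 < 1 - 2 * α := by linarith
  rw [abs_of_pos (by positivity), le_div_iff₀ h1]
  linarith

/-- `K` vanishes at the minimum, where `u = 0`, but is positive elsewhere. Among at least two other
distinct observations, one is nonzero. -/
theorem l2norm_coeffK_pos (hcard : 3 ≤ Fintype.card V) {X : V → ℝ} (hX : Function.Injective X) :
    0 < l2norm (fun k => coeffK 0 X k * X k) := by
  have : Nonempty V := Fintype.card_pos_iff.1 (by omega)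
  obtain ⟨k₀, hk₀⟩ := Finite.exists_min X
  have hex : ∃ k, k ≠ k₀ ∧ X k ≠ 0 := by
    by_contra hno
    push Not at hno
    have hlt : 1 < (Finset.univ.erase k₀).card := by
      rw [Finset.card_erase_of_mem (Finset.mem_univ _), Finset.card_univ]; omega
    obtain ⟨a, ha, b, hb, hab⟩ := Finset.one_lt_card.1 hlt
    exact hab (hX ((hno a (Finset.ne_of_mem_erase ha)).trans
      (hno b (Finset.ne_of_mem_erase hb)).symm))
  obtain ⟨k, hk, hXk⟩ := hex
  have hlt : X k₀ < X k := lt_of_le_of_ne (hk₀ k) fun h => hk (hX h.symm)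
  have hn : (0 : ℝ) < Fintype.card V := by exact_mod_cast Fintype.card_pos
  have hr2 : (2 : ℝ) ≤ rank X k := by
    have : 0 < (Finset.univ.filter fun l => X l < X k).card :=
      Finset.card_pos.2 ⟨k₀, by simpa using hlt⟩
    rw [rank]
    push_cast
    have : (1 : ℝ) ≤ (Finset.univ.filter fun l => X l < X k).card := by exact_mod_cast this
    linarith
  have hrn : (rank X k : ℝ) ≤ Fintype.card V := by
    have : (Finset.univ.filter fun l => X l < X k).card < Fintype.card V :=
      Finset.card_lt_univ_of_notMem (x := k) (by simp)
    rw [rank]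
    exact_mod_cast (by omega)
  have hu0 : 0 < ((rank X k : ℝ) - 1) / Fintype.card V := div_pos (by linarith) hn
  have hu1 : 0 < 1 - ((rank X k : ℝ) - 1) / Fintype.card V := by
    rw [sub_pos, div_lt_one hn]; linarith
  have hscore : 0 < score (((rank X k : ℝ) - 1) / Fintype.card V) :=
    Real.sqrt_pos.2 (mul_pos hu0 hu1)
  have hK : 0 < coeffK 0 X k := by
    have := gap_pos 0 X k
    rw [coeffK, rankSigma, mul_zero, sub_zero, mul_one]
    positivity
  refine lt_of_le_of_ne (l2norm_nonneg _) fun h => ?_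
  have h0 : (fun k => coeffK 0 X k * X k) ⬝ᵥ (fun k => coeffK 0 X k * X k) = 0 := by
    rw [← l2norm_sq, ← h]; simp
  have h1 := congrFun (dotProduct_self_eq_zero.1 h0) k
  exact mul_ne_zero hK.ne' hXk h1

/-- A graph on at most two vertices is 2-colourable. -/
theorem three_le_card_of_not_isBipartite [Nontrivial V] {G : SimpleGraph V}
    (hG : ¬ G.IsBipartite) : 3 ≤ Fintype.card V := by
  by_contra h
  exact hG (G.colorable_of_fintype.mono (by omega))

/-- The contribution of the first injection is eventually negligible. -/
theorem exists_forall_pow_mul_le {x : ℝ} (hx0 : 0 < x) (hx1 : x ≤ 1) (M : ℝ) {κ : ℝ} (hκ : 0 < κ) :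
    ∃ T : ℝ, ∀ t : ℕ, T < t → (1 - x) ^ t * M * (2 * t) ≤ κ := by
  have h : Filter.Tendsto (fun t : ℕ => (t : ℝ) ^ 1 * (1 - x) ^ t * (2 * M)) Filter.atTop
      (nhds (0 * (2 * M))) :=
    (tendsto_pow_const_mul_const_pow_of_abs_lt_one 1
      (abs_lt.2 ⟨by linarith, by linarith⟩)).mul_const _
  rw [zero_mul] at h
  obtain ⟨N, hN⟩ := Filter.eventually_atTop.1 (h.eventually (gt_mem_nhds hκ))
  refine ⟨N, fun t ht => ?_⟩
  have := (hN t (by exact_mod_cast ht.le)).le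
  calc _ = _ := by ring
    _ ≤ _ := this

end GoTrim

/-! ### Choice of the thresholds and conclusion -/

theorem theorem3 :
    ∃ C : ℝ, 0 < C ∧ ∃ T₀ : ℝ → ℝ,
      ∀ (V : Type*) [Fintype V] [DecidableEq V] [Nontrivial V]
        (X : V → ℝ), Function.Injective X →
      ∃ T₁ : ℝ → ℝ,
      ∀ (G : SimpleGraph V), G.Connected → ¬ G.IsBipartite →
      ∀ (p : Sym2 V → ℝ), GoTrim.IsEdgeDistribution G p →
      ∀ α : ℝ, 0 < α → α < 1 / 2 →
      ∃ Tstar : ℝ, 0 < Tstar ∧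
        Tstar ≤ T₁ (GoTrim.cTilde p) ∧
        (1 ≤ GoTrim.trimCount V α → Tstar ≤ T₀ (GoTrim.cTilde p)) ∧
        ∀ (Ω : Type*) [MeasurableSpace Ω] (μ : MeasureTheory.Measure Ω)
          [MeasureTheory.IsProbabilityMeasure μ] (ξ : ℕ → Ω → Sym2 V),
          GoTrim.IsEdgeSampling μ p ξ →
          ∀ t : ℕ, Tstar < (t : ℝ) →
            ∫ ω, GoTrim.l2norm (fun k =>
                GoTrim.estimate α X (fun s => ξ s ω) t k - GoTrim.trimmedMean α X) ∂μ
              ≤ C * (1 / (GoTrim.cTilde p * √(GoTrim.spectralGap p * (t : ℝ)))) *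
                  GoTrim.l2norm (fun k => GoTrim.coeffK α X k * X k) := by
  -- `10 = 9 + 1`: the extra unit absorbs the first injection when `m = 0`. For `m ≥ 1` there is
  -- none, and the threshold `1` only excludes small `t`.
  refine ⟨10, by norm_num, fun _ => 1, fun V _ _ _ X hX => ?_⟩
  -- A threshold is fixed for every possible value `x` of `c̃` before the graph is given; outside
  -- the relevant range it is the dummy value `0`.
  have hT : ∀ x : ℝ, ∃ T : ℝ, 0 < x → x ≤ 1 → 3 ≤ Fintype.card V → ∀ t : ℕ, T < t →
      (1 - x) ^ t * GoTrim.l2norm X * (2 * t) ≤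
        GoTrim.l2norm (fun k => GoTrim.coeffK 0 X k * X k) := by
    intro x
    by_cases h : 0 < x ∧ x ≤ 1 ∧ 3 ≤ Fintype.card V
    · obtain ⟨T, hT⟩ := GoTrim.exists_forall_pow_mul_le h.1 h.2.1 (GoTrim.l2norm X)
        (GoTrim.l2norm_coeffK_pos h.2.2 hX)
      exact ⟨T, fun _ _ _ => hT⟩
    · exact ⟨0, fun h1 h2 h3 => absurd ⟨h1, h2, h3⟩ h⟩
  choose T hT using hT
  refine ⟨fun x => max 1 (T x), fun G hG hbip p hp α hα hα2 => ?_⟩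
  have hc := hp.spectralGap_pos hG
  have hct := hp.cTilde_pos hG
  have hct1 := GoTrim.cTilde_le_one p
  by_cases hm : 1 ≤ GoTrim.trimCount V α
  · refine ⟨1, one_pos, le_max_left _ _, fun _ => le_rfl, fun Ω _ μ _ ξ hξ t ht => ?_⟩
    have ht0 : 0 < t := by
      have : (0 : ℝ) < t := by linarith
      exact_mod_cast this
    have h := hξ.integral_l2norm_estimate_sub_le hp hG hα hα2 X ht0
    rw [GoTrim.weightFun_one_of_trimCount_pos hm, zero_mul, mul_zero, zero_add] at h
    refine h.trans ?_
    rw [mul_assoc, one_div_mul_eq_div]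
    have := GoTrim.l2norm_nonneg (fun k => GoTrim.coeffK α X k * X k)
    gcongr
    norm_num
  · refine ⟨max 1 (T (GoTrim.cTilde p)), by positivity, le_rfl, fun h => absurd h hm,
      fun Ω _ μ _ ξ hξ t ht => ?_⟩
    obtain ⟨ht1, htT⟩ := max_lt_iff.1 ht
    have ht0 : 0 < t := by
      have : (0 : ℝ) < t := by linarith
      exact_mod_cast this
    have hm0 : GoTrim.trimCount V α = 0 := by omega
    have h := hξ.integral_l2norm_estimate_sub_le hp hG hα hα2 X ht0
    have h2 := (hT _ hct hct1 (GoTrim.three_le_card_of_not_isBipartite hbip) t htT).trans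
      (GoTrim.l2norm_coeffK_le_of_trimCount_eq_zero hα hα2 hm0 X)
    have hpow : 0 ≤ (1 - GoTrim.cTilde p) ^ t := pow_nonneg (by linarith) _
    have hs : 0 < √(GoTrim.spectralGap p * t) := Real.sqrt_pos.2 (by positivity)
    -- `c ≤ 2` and `t ≥ 1` give `√(c t) ≤ 2t`, so the threshold need not involve `c`.
    have hs2 : GoTrim.cTilde p * √(GoTrim.spectralGap p * t) ≤ 2 * t := by
      refine (mul_le_of_le_one_left hs.le hct1).trans (Real.sqrt_le_iff.2 ⟨by positivity, ?_⟩)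
      have := hp.spectralGap_le_two
      nlinarith
    have h3 : (1 - GoTrim.cTilde p) ^ t * (GoTrim.weightFun V α 1 * GoTrim.l2norm X) ≤
        GoTrim.l2norm (fun k => GoTrim.coeffK α X k * X k) /
          (GoTrim.cTilde p * √(GoTrim.spectralGap p * t)) := by
      rw [le_div_iff₀ (by positivity)]
      have hX0 := GoTrim.l2norm_nonneg X
      calc _ ≤ (1 - GoTrim.cTilde p) ^ t * (1 * GoTrim.l2norm X) *
            (GoTrim.cTilde p * √(GoTrim.spectralGap p * t)) := by
              gcongr
              exact GoTrim.weightFun_one_le_of_trimCount_eq_zero hm0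
        _ ≤ (1 - GoTrim.cTilde p) ^ t * (1 * GoTrim.l2norm X) * (2 * t) := by gcongr
        _ ≤ _ := by rw [one_mul]; exact h2
    rw [mul_assoc, one_div_mul_eq_div]
    linarith
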